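/- Let $\mathfrak g$ be a finite-dimensional reductive Lie algebra over $\mathbb C$ with Cartan subalgebra $\mathfrak h$ and root system $\Delta\subset\mathfrak h^*$. A $(\mathfrak g,\mathfrak h)$-module is a $\mathfrak g$-module that is locally finite and semisimple as an $\mathfrak h$-module, and $\mathrm{Ext}^i_{\mathfrak g,\mathfrak h}$ denotes $\mathrm{Ext}^i$ in the abelian category of $(\mathfrak g,\mathfrak h)$-modules. Let $\Gamma=\{\gamma_1,\dots,\gamma_l\}\subset\Delta$ be a commuting set of roots, i.e. $\alpha+\beta\notin\Delta\cup\{0\}$ for all $\alpha,\beta\in\Gamma$; for $\gamma\in\Gamma$ let $f_\gamma$ be a nonzero vector of the root space $\mathfrak g_{-\gamma}$. Let $U_\Gamma$ be the localization of $U(\mathfrak g)$ relative to the multiplicative set generated by the $f_\gamma$, $\gamma\in\Gamma$. A $(\mathfrak g,\mathfrak h)$-module is $\Gamma$-bijective if every $f_\gamma$, $\gamma\in\Gamma$, acts bijectively on it; such a module is canonically a $U_\Gamma$-module. For $x=(x_1,\dots,x_l)\in\mathbb C^l$ let $\Theta_x$ be the automorphism of $U_\Gamma$ belonging to the unique family of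 automorphisms such that $$\Theta_x(u)=f_{\gamma_1}^{x_1}\cdots f_{\gamma_l}^{x_l}\,u\,f_{\gamma_l}^{-x_l}\cdots f_{\gamma_1}^{-x_1}\qquad(x\in\mathbb Z^l,\ u\in U_\Gamma)$$ and such that $x\mapsto\Theta_x(u)$ is polynomial on $\mathbb C^l$ for every $u\in U_\Gamma$. For a $\Gamma$-bijective $(\mathfrak g,\mathfrak h)$-module $M$ and $\nu=x_1\gamma_1+\dots+x_l\gamma_l\in\mathfrak h^*$, let $\Phi^\nu_\Gamma M$ be the vector space $M$ on which $u\in U_\Gamma$ acts by the original action of $\Theta_x(u)$; it is again a $\Gamma$-bijective $(\mathfrak g,\mathfrak h)$-module. (If $\Gamma$ is linearly dependent, $\Phi^\nu_\Gamma$ is formed with any chosen $x$ with $\nu=\sum_j x_j\gamma_j$, the same for all modules.) Then for all $\Gamma$-bijective $(\mathfrak g,\mathfrak h)$-modules $M,N$, all $x\in\mathbb C^l$ with $\nu=x_1\gamma_1+\dots+x_l\gamma_l$, and all $i\in\mathbb N$, there is an isomorphism of complex vector spaces $$\mathrm{Ext}^i_{\mathfrak g,\mathfrak h}(M,N)\cong\mathrm{Ext}^i_{\mathfrak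 g,\mathfrak h}(\Phi^\nu_\Gamma M,\Phi^\nu_\Gamma N).$$ -/

import Mathlib

universe u

namespace WeightMod

section Polynomial

variable {ι V W : Type*} [AddCommGroup V] [Module ℂ V] [AddCommGroup W] [Module ℂ W]

/-- The space of polynomial maps from `ℂ^ι` to a complex vector space `V`: the finite sums of
maps `x ↦ p(x) • v` with `p` a polynomial in the coordinates and `v` a vector. -/
def polyMap (ι V : Type*) [AddCommGroup V] [Module ℂ V] : Submodule ℂ ((ι → ℂ) → V) :=
  Submodule.span ℂ {g | ∃ (p : MvPolynomial ι ℂ) (v : V), g = fun x => MvPolynomial.eval x p • v}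

theorem smul_mem_polyMap (p : MvPolynomial ι ℂ) (v : V) :
    (fun x => MvPolynomial.eval x p • v) ∈ polyMap ι V :=
  Submodule.subset_span ⟨p, v, rfl⟩

theorem const_mem_polyMap (v : V) : (fun _ => v) ∈ polyMap ι V := by
  simpa using smul_mem_polyMap (ι := ι) 1 v

theorem polyMap_induction {P : ((ι → ℂ) → V) → Prop}
    (h1 : ∀ (p : MvPolynomial ι ℂ) (v : V), P (fun x => MvPolynomial.eval x p • v))
    (h0 : P 0) (hadd : ∀ g g', P g → P g' → P (g + g')) {g : (ι → ℂ) → V}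
    (hg : g ∈ polyMap ι V) : P g := by
  have key : ∀ e : ℂ, P (e • g) := by
    induction hg using Submodule.span_induction with
    | mem g hg =>
      intro e
      obtain ⟨p, v, rfl⟩ := hg
      have := h1 (MvPolynomial.C e * p) v
      convert this using 1
      ext x; simp [mul_smul]
    | zero => intro e; simpa using h0
    | add g g' _ _ h h' => intro e; rw [smul_add]; exact hadd _ _ (h e) (h' e)
    | smul d g _ ih => intro e; rw [smul_smul]; exact ih _
  simpa using key 1

/-- A map that is pointwise linear in a vector and polynomial in the parameter
sends polynomial families to polynomial families. -/
theorem apply_mem_polyMap {T : (ι → ℂ) → V →ₗ[ℂ] W}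
    (hT : ∀ v, (fun x => T x v) ∈ polyMap ι W) {g : (ι → ℂ) → V} (hg : g ∈ polyMap ι V) :
    (fun x => T x (g x)) ∈ polyMap ι W := by
  refine polyMap_induction (P := fun g => (fun x => T x (g x)) ∈ polyMap ι W) ?_ ?_ ?_ hg
  · intro p v
    simp only [map_smul]
    refine polyMap_induction (P := fun g => (fun x => MvPolynomial.eval x p • g x) ∈ polyMap ι W)
      ?_ ?_ ?_ (hT v)
    · intro q w
      simpa [mul_smul] using smul_mem_polyMap (p * q) w
    · simp only [Pi.zero_apply, smul_zero]; exact (polyMap ι W).zero_mem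
    · intro g g' h h'
      simpa [smul_add] using! (polyMap ι W).add_mem h h'
  · simp only [Pi.zero_apply, map_zero]; exact (polyMap ι W).zero_mem
  · intro g g' h h'
    simpa using! (polyMap ι W).add_mem h h'

theorem map_mem_polyMap (T : V →ₗ[ℂ] W) {g : (ι → ℂ) → V} (hg : g ∈ polyMap ι V) :
    (fun x => T (g x)) ∈ polyMap ι W :=
  apply_mem_polyMap (T := fun _ => T) (fun v => const_mem_polyMap (T v)) hg

theorem mul_mem_polyMap {R : Type*} [Ring R] [Algebra ℂ R] {g g' : (ι → ℂ) → R}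
    (hg : g ∈ polyMap ι R) (hg' : g' ∈ polyMap ι R) :
    (fun x => g x * g' x) ∈ polyMap ι R :=
  apply_mem_polyMap (T := fun x => LinearMap.mulLeft ℂ (g x))
    (fun v => map_mem_polyMap (LinearMap.mulRight ℂ v) hg) hg'

/-- Polynomial families may be reparametrised polynomially. -/
theorem comp_mem_polyMap (q : ι → MvPolynomial ι ℂ) {g : (ι → ℂ) → V} (hg : g ∈ polyMap ι V) :
    (fun x => g (fun i => MvPolynomial.eval x (q i))) ∈ polyMap ι V := by
  refine polyMap_induction
    (P := fun g => (fun x => g (fun i => MvPolynomial.eval x (q i))) ∈ polyMap ι V) ?_ ?_ ?_ hg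
  · intro p v
    have := smul_mem_polyMap (MvPolynomial.bind₁ q p) v
    convert this using 3 with x
    simp only [← MvPolynomial.aeval_eq_eval, MvPolynomial.aeval_bind₁]
  · exact (polyMap ι V).zero_mem
  · intro g g' h h'
    simpa using! (polyMap ι V).add_mem h h'

/-- Two polynomial maps that agree on `ℕ^ι` are equal. -/
theorem polyMap_ext [Finite ι] {g g' : (ι → ℂ) → V} (hg : g ∈ polyMap ι V) (hg' : g' ∈ polyMap ι V)
    (h : ∀ n : ι → ℕ, g (fun i => (n i : ℂ)) = g' (fun i => (n i : ℂ))) (x : ι → ℂ) :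
    g x = g' x := by
  rw [← sub_eq_zero]
  rw [← Module.forall_dual_apply_eq_zero_iff ℂ]
  intro φ
  have hp : ∃ p : MvPolynomial ι ℂ, ∀ x, φ (g x - g' x) = MvPolynomial.eval x p := by
    have := (polyMap ι V).sub_mem hg hg'
    refine polyMap_induction (P := fun g => ∃ p : MvPolynomial ι ℂ, ∀ x,
      φ (g x) = MvPolynomial.eval x p) ?_ ?_ ?_ this
    · intro p v
      exact ⟨MvPolynomial.C (φ v) * p, fun x => by simp [mul_comm]⟩
    · exact ⟨0, by simp⟩
    · rintro g g' ⟨p, hp⟩ ⟨p', hp'⟩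
      exact ⟨p + p', fun x => by simp [hp, hp']⟩
  obtain ⟨p, hp⟩ := hp
  have : p = 0 := by
    refine MvPolynomial.funext_set (fun _ => Set.range (fun n : ℕ => (n : ℂ)))
      (fun _ => Set.infinite_range_of_injective Nat.cast_injective) ?_
    intro x hx
    choose n hn using fun i => hx i (Set.mem_univ i)
    obtain rfl : (fun i => (n i : ℂ)) = x := funext hn
    rw [← hp, h]; simp
  rw [hp, this]; simp

end Polynomial

section Ore

variable {R : Type*} [Ring R]

theorem ore_aux (s : R) (N : ℕ) (r : R) (h : (fun t => s * t - t * s)^[N] r = 0) :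
    ∃ r', s ^ N * r = r' * s := by
  induction N generalizing r with
  | zero => exact ⟨0, by simpa using h⟩
  | succ N ih =>
    obtain ⟨r', hr'⟩ := ih _ h
    refine ⟨r' + s ^ N * r, ?_⟩
    rw [add_mul, ← hr', pow_succ]; noncomm_ring

theorem ore_cancel_aux (s : R) (N : ℕ) (r : R) (h : (fun t => s * t - t * s)^[N] r = 0)
    (h0 : r * s = 0) : s ^ N * r = 0 := by
  induction N generalizing r with
  | zero => simpa using h
  | succ N ih =>
    have := ih (s * r - r * s) h (by rw [h0, sub_zero, mul_assoc, h0, mul_zero])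
    rw [h0, sub_zero] at this
    rw [pow_succ, mul_assoc]; exact this

/-- The Ore condition for the multiplicative set generated by elements whose inner derivations
are locally nilpotent. -/
theorem nonempty_oreSet {ι : Type*} (s : ι → R)
    (hs : ∀ i r, ∃ N, (fun t => s i * t - t * s i)^[N] r = 0) :
    Nonempty (OreLocalization.OreSet (Submonoid.closure (Set.range s))) := by
  rw [OreLocalization.nonempty_oreSet_iff]
  set S := Submonoid.closure (Set.range s)
  have hS : ∀ i, s i ∈ S := fun i => Submonoid.subset_closure ⟨i, rfl⟩
  constructor
  · suffices ∀ t ∈ S, ∀ r : R, r * t = 0 → ∃ s' : S, (s' : R) * r = 0 by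
      intro r₁ r₂ t h
      obtain ⟨s', hs'⟩ := this t t.2 (r₁ - r₂) (by rw [sub_mul, h, sub_self])
      exact ⟨s', by rwa [mul_sub, sub_eq_zero] at hs'⟩
    intro t ht
    induction ht using Submonoid.closure_induction with
    | mem t ht =>
      obtain ⟨i, rfl⟩ := ht
      intro r hr
      obtain ⟨N, hN⟩ := hs i r
      exact ⟨⟨s i ^ N, S.pow_mem (hS i) N⟩, ore_cancel_aux _ N r hN hr⟩
    | one => intro r hr; exact ⟨1, by simpa using hr⟩
    | mul a b _ _ iha ihb =>
      intro r hr
      obtain ⟨s₁, h₁⟩ := ihb (r * a) (by rwa [mul_assoc])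
      obtain ⟨s₂, h₂⟩ := iha (s₁ * r) (by rwa [mul_assoc])
      exact ⟨s₂ * s₁, by simpa [mul_assoc] using h₂⟩
  · intro r ⟨t, ht⟩
    induction ht using Submonoid.closure_induction generalizing r with
    | mem t ht =>
      obtain ⟨i, rfl⟩ := ht
      obtain ⟨N, hN⟩ := hs i r
      obtain ⟨r', hr'⟩ := ore_aux _ N r hN
      exact ⟨r', ⟨s i ^ N, S.pow_mem (hS i) N⟩, hr'⟩
    | one => exact ⟨r, 1, by simp⟩
    | mul a b _ _ iha ihb =>
      obtain ⟨r₁, s₁, h₁⟩ := ihb r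
      obtain ⟨r₂, s₂, h₂⟩ := iha r₁
      refine ⟨r₂, s₂ * s₁, ?_⟩
      simp only at h₁ h₂ ⊢
      rw [Submonoid.coe_mul, mul_assoc, h₁, ← mul_assoc, h₂, mul_assoc]

theorem iterate_zero_ad (s : R) (N : ℕ) : (fun t => s * t - t * s)^[N] 0 = 0 := by
  induction N with
  | zero => rfl
  | succ N ih => rw [Function.iterate_succ_apply]; simpa using ih

theorem iterate_add_ad (s : R) (N : ℕ) (a b : R) : (fun t => s * t - t * s)^[N] (a + b) =
    (fun t => s * t - t * s)^[N] a + (fun t => s * t - t * s)^[N] b := by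
  induction N generalizing a b with
  | zero => rfl
  | succ N ih =>
    simp only [Function.iterate_succ_apply]
    rw [← ih]; congr 1; noncomm_ring

theorem iterate_mul_ad (s : R) (k : ℕ) : ∀ (n m : ℕ) (a b : R), n + m = k →
    (fun t => s * t - t * s)^[n] a = 0 → (fun t => s * t - t * s)^[m] b = 0 →
    (fun t => s * t - t * s)^[k] (a * b) = 0 := by
  induction k with
  | zero =>
    intro n m a b h ha hb
    obtain rfl : n = 0 := by omega
    have : a = 0 := ha
    simp [this]
  | succ k ih =>
    intro n m a b h ha hb
    rcases n with _ | n
    · have : a = 0 := ha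
      rw [this, zero_mul, iterate_zero_ad]
    rcases m with _ | m
    · have : b = 0 := hb
      rw [this, mul_zero, iterate_zero_ad]
    rw [Function.iterate_succ_apply]
    have h1 := ih n (m + 1) (s * a - a * s) b (by omega) ha hb
    have h2 := ih (n + 1) m a (s * b - b * s) (by omega) ha hb
    have : s * (a * b) - a * b * s = (s * a - a * s) * b + a * (s * b - b * s) := by noncomm_ring
    simp only [this]
    rw [iterate_add_ad, h1, h2, add_zero]

end Ore

section Enveloping

attribute [local instance 100] LieRing.ofAssociativeRing

variable {L : Type*} [LieRing L] [LieAlgebra ℂ L]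

theorem enveloping_eq_top (S : Subalgebra ℂ (UniversalEnvelopingAlgebra ℂ L))
    (h : ∀ X, UniversalEnvelopingAlgebra.ι ℂ X ∈ S) : S = ⊤ := by
  let F : L →ₗ⁅ℂ⁆ S :=
    { toFun := fun X => ⟨UniversalEnvelopingAlgebra.ι ℂ X, h X⟩
      map_add' := fun X Y => Subtype.ext (by simp)
      map_smul' := fun c X => Subtype.ext (by simp)
      map_lie' := fun {X Y} => Subtype.ext
        (LieHom.map_lie (UniversalEnvelopingAlgebra.ι ℂ) X Y) }
  have key : S.val.comp (UniversalEnvelopingAlgebra.lift ℂ F) = AlgHom.id ℂ _ := by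
    apply UniversalEnvelopingAlgebra.hom_ext
    ext X
    simp [F]
  rw [eq_top_iff]
  intro x _
  have := DFunLike.congr_fun key x
  simp only [AlgHom.comp_apply, AlgHom.id_apply] at this
  rw [← this]
  exact (UniversalEnvelopingAlgebra.lift ℂ F x).2

theorem enveloping_locally_nilpotent {X : L} (hX : IsNilpotent (LieAlgebra.ad ℂ L X))
    (r : UniversalEnvelopingAlgebra ℂ L) :
    ∃ N, (fun t => UniversalEnvelopingAlgebra.ι ℂ X * t
      - t * UniversalEnvelopingAlgebra.ι ℂ X)^[N] r = 0 := by
  set s := UniversalEnvelopingAlgebra.ι ℂ X with hs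
  have hmono : ∀ (N M : ℕ) (r), (fun t => s * t - t * s)^[N] r = 0 →
      (fun t => s * t - t * s)^[M + N] r = 0 := by
    intro N M r h
    rw [Function.iterate_add_apply, h, iterate_zero_ad]
  let S : Subalgebra ℂ (UniversalEnvelopingAlgebra ℂ L) :=
    { carrier := {r | ∃ N, (fun t => s * t - t * s)^[N] r = 0}
      mul_mem' := by
        rintro a b ⟨n, hn⟩ ⟨m, hm⟩
        exact ⟨n + m, iterate_mul_ad s _ n m a b rfl hn hm⟩
      add_mem' := by
        rintro a b ⟨n, hn⟩ ⟨m, hm⟩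
        refine ⟨n + m, ?_⟩
        rw [iterate_add_ad, hmono _ _ _ hm, add_comm n m, hmono _ _ _ hn, add_zero]
      algebraMap_mem' := fun c => ⟨1, by
        simp [Algebra.commutes]⟩ }
  have hS : S = ⊤ := by
    apply enveloping_eq_top
    intro Y
    obtain ⟨N, hN⟩ := hX
    refine ⟨N, ?_⟩
    have key : ∀ (n : ℕ) (Y : L), (fun t => s * t - t * s)^[n] (UniversalEnvelopingAlgebra.ι ℂ Y)
        = UniversalEnvelopingAlgebra.ι ℂ (((LieAlgebra.ad ℂ L X) ^ n) Y) := by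
      intro n
      induction n with
      | zero => intro Y; simp
      | succ n ih =>
        intro Y
        rw [Function.iterate_succ_apply, pow_succ, Module.End.mul_apply, ← ih,
          LieAlgebra.ad_apply, LieHom.map_lie]
        rfl
    rw [key, hN]; simp
  have : r ∈ S := by rw [hS]; trivial
  exact this

end Enveloping

section Twist

variable {ι R : Type*} [Ring R]

theorem pairwise_zpow (F : ι → Rˣ) (hF : ∀ i j, Commute (F i) (F j)) (n : ι → ℤ) (s : Finset ι) :
    (s : Set ι).Pairwise (Function.onFun Commute fun i => F i ^ n i) :=
  fun i _ j _ _ => (hF i j).zpow_zpow (n i) (n j)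

/-- The product `∏ i, F i ^ n i` of integral powers of commuting units. -/
noncomputable def unitMonomial [Fintype ι] (F : ι → Rˣ) (hF : ∀ i j, Commute (F i) (F j))
    (n : ι → ℤ) : Rˣ :=
  Finset.univ.noncommProd (fun i => F i ^ n i) (pairwise_zpow F hF n Finset.univ)

/-- `Θ` is the family of automorphisms `Θ x` of `R`, indexed by `x ∈ ℂ^ι`, such that `Θ x` is the
conjugation by `∏ i, F i ^ x i` when all `x i` are integers and such that
`Θ x r` is polynomial in `x` for every `r`. -/
structure IsTwistFamily [Fintype ι] [Algebra ℂ R] (F : ι → Rˣ) (hF : ∀ i j, Commute (F i) (F j))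
    (Θ : (ι → ℂ) → R ≃ₐ[ℂ] R) : Prop where
  conj : ∀ (n : ι → ℤ) (r : R), Θ (fun i => (n i : ℂ)) r =
    (unitMonomial F hF n : R) * r * ((unitMonomial F hF n)⁻¹ : Rˣ)
  poly : ∀ r : R, (fun x => Θ x r) ∈ polyMap ι R

theorem unitMonomial_add [Fintype ι] (F : ι → Rˣ) (hF : ∀ i j, Commute (F i) (F j))
    (n m : ι → ℤ) : unitMonomial F hF (n + m) = unitMonomial F hF n * unitMonomial F hF m := by
  unfold unitMonomial
  rw [← Finset.noncommProd_mul_distrib (fun i => F i ^ n i) (fun i => F i ^ m i)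
    (pairwise_zpow F hF n _) (pairwise_zpow F hF m _)
    fun i _ j _ _ => (hF i j).zpow_zpow (m i) (n j)]
  apply Finset.noncommProd_congr rfl
  intro i _
  simp [zpow_add]

theorem unitMonomial_neg [Fintype ι] (F : ι → Rˣ) (hF : ∀ i j, Commute (F i) (F j))
    (n : ι → ℤ) : unitMonomial F hF (-n) = (unitMonomial F hF n)⁻¹ := by
  rw [eq_inv_iff_mul_eq_one, ← unitMonomial_add, neg_add_cancel]
  exact (Finset.noncommProd_eq_pow_card _ _ _ 1 (by simp)).trans (one_pow _)

theorem unitMonomial_commute [Fintype ι] (F : ι → Rˣ) (hF : ∀ i j, Commute (F i) (F j))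
    (n : ι → ℤ) (i : ι) : Commute (F i) (unitMonomial F hF n) :=
  Finset.noncommProd_commute _ _ _ _ fun j _ => (hF i j).zpow_right (n j)

variable [Algebra ℂ R]

/-- Conjugation by a unit, as a linear map. -/
def conjLin (u : Rˣ) : R →ₗ[ℂ] R :=
  LinearMap.mulLeft ℂ (u : R) ∘ₗ LinearMap.mulRight ℂ ((u⁻¹ : Rˣ) : R)

theorem conjLin_apply (u : Rˣ) (r : R) : conjLin u r = (u : R) * r * (u⁻¹ : Rˣ) := by
  simp [conjLin, mul_assoc]

theorem conjLin_mul (u v : Rˣ) : conjLin (u * v) = conjLin u * conjLin v := by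
  ext r
  simp [conjLin_apply, mul_assoc]

theorem conjLin_one : conjLin (1 : Rˣ) = 1 := by
  ext r
  simp [conjLin_apply]

theorem conjLin_pow (u : Rˣ) (n : ℕ) : conjLin (u ^ n) = conjLin u ^ n := by
  induction n with
  | zero => simp [conjLin_one]
  | succ n ih => rw [pow_succ, conjLin_mul, ih, pow_succ]

theorem conjLin_sub_one_pow (u : Rˣ) (N : ℕ) (r : R) :
    ((conjLin u - 1) ^ N) r =
      (fun t => (u : R) * t - t * u)^[N] r * ((u⁻¹ ^ N : Rˣ) : R) := by
  induction N with
  | zero => simp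
  | succ N ih =>
    rw [pow_succ', Module.End.mul_apply, ih, Function.iterate_succ_apply']
    generalize (fun t => (u : R) * t - t * u)^[N] r = y
    have h : (u : R) * ((u⁻¹ ^ N : Rˣ) : R) * ((u⁻¹ : Rˣ) : R) = ((u⁻¹ ^ N : Rˣ) : R) := by
      rw [← Units.val_mul, ← Units.val_mul]; congr 1; group
    rw [LinearMap.sub_apply, conjLin_apply, Module.End.one_apply, pow_succ, Units.val_mul, sub_mul]
    congr 1
    · simp only [mul_assoc]
    · simp only [mul_assoc]
      congr 1
      rw [← Units.val_mul, ← Units.val_mul]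
      congr 1; group

/-- Powers of a locally unipotent conjugation depend polynomially on the exponent. -/
theorem exists_poly_conj_pow (u : Rˣ) (hu : ∀ r, ∃ N, (fun t => (u : R) * t - t * u)^[N] r = 0)
    (i : ι) (r : R) :
    ∃ g ∈ polyMap ι R, ∀ n : ι → ℕ, g (fun j => (n j : ℂ)) = (conjLin u ^ n i) r := by
  obtain ⟨K, hK⟩ := hu r
  have hK' : ∀ k, K ≤ k → ((conjLin u - 1) ^ k) r = 0 := by
    intro k hk
    obtain ⟨m, rfl⟩ := Nat.exists_eq_add_of_le hk
    rw [add_comm, pow_add, Module.End.mul_apply, conjLin_sub_one_pow u K, hK, zero_mul, map_zero]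
  let p : ℕ → MvPolynomial ι ℂ := fun k =>
    MvPolynomial.C ((k.factorial : ℂ)⁻¹) * Polynomial.aeval (MvPolynomial.X i) (descPochhammer ℂ k)
  have hp : ∀ k (n : ι → ℕ), MvPolynomial.eval (fun j => (n j : ℂ)) (p k) = (n i).choose k := by
    intro k n
    have : MvPolynomial.eval (fun j => (n j : ℂ))
        (Polynomial.aeval (MvPolynomial.X i) (descPochhammer ℂ k)) =
        (descPochhammer ℂ k).eval (n i : ℂ) := by
      rw [← MvPolynomial.aeval_eq_eval]
      rw [← Polynomial.aeval_algHom_apply]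
      simp [Polynomial.aeval_def, Polynomial.eval₂_eq_eval_map]
    simp only [p, map_mul, MvPolynomial.eval_C, this, descPochhammer_eval_eq_descFactorial]
    rw [Nat.descFactorial_eq_factorial_mul_choose]
    push_cast
    rw [inv_mul_cancel_left₀]
    exact_mod_cast Nat.factorial_ne_zero k
  refine ⟨fun x => ∑ k ∈ Finset.range K, MvPolynomial.eval x (p k) • ((conjLin u - 1) ^ k) r,
    ?_, ?_⟩
  · have := (polyMap ι R).sum_mem (t := Finset.range K)
      (f := fun k x => MvPolynomial.eval x (p k) • ((conjLin u - 1) ^ k) r)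
      fun k _ => smul_mem_polyMap (p k) _
    convert this using 1
    ext x; simp
  · intro n
    have h1 : conjLin u = (conjLin u - 1) + 1 := by simp
    conv_rhs => rw [h1, (Commute.one_right _).add_pow]
    simp only [hp, one_pow, mul_one, LinearMap.sum_apply]
    have h2 : ∀ k, ((conjLin u - 1) ^ k * ((n i).choose k : Module.End ℂ R)) r =
        ((n i).choose k : ℂ) • ((conjLin u - 1) ^ k) r := by
      intro k
      rw [Module.End.mul_apply, Module.End.natCast_apply, map_nsmul, Nat.cast_smul_eq_nsmul]
    simp only [h2]
    rcases le_total K (n i + 1) with h | h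
    · refine Finset.sum_subset (Finset.range_subset_range.2 h) ?_
      intro k _ hk
      rw [hK' k (by simpa using hk), smul_zero]
    · symm
      refine Finset.sum_subset (Finset.range_subset_range.2 h) ?_
      intro k _ hk
      rw [Nat.choose_eq_zero_of_lt (by simpa using hk)]; simp

theorem exists_poly_conj [Fintype ι] (F : ι → Rˣ) (hF : ∀ i j, Commute (F i) (F j))
    (hN : ∀ i r, ∃ N, (fun t => (F i : R) * t - t * F i)^[N] r = 0) (r : R) :
    ∃ g ∈ polyMap ι R, ∀ n : ι → ℕ, g (fun j => (n j : ℂ)) =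
      conjLin (unitMonomial F hF fun i => (n i : ℤ)) r := by
  classical
  have hc : ∀ (n : ι → ℕ) (s : Finset ι),
      (s : Set ι).Pairwise (Function.onFun Commute fun i => F i ^ n i) :=
    fun n s i _ j _ _ => (hF i j).pow_pow (n i) (n j)
  suffices ∀ s : Finset ι, ∃ g ∈ polyMap ι R, ∀ n : ι → ℕ, g (fun j => (n j : ℂ)) =
      conjLin (s.noncommProd (fun i => F i ^ n i) (hc n s)) r by
    obtain ⟨g, hg, h⟩ := this Finset.univ
    refine ⟨g, hg, fun n => ?_⟩
    rw [h, unitMonomial]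
    congr 2
  intro s
  induction s using Finset.induction_on with
  | empty => exact ⟨fun _ => r, const_mem_polyMap r, fun n => by simp [conjLin_one]⟩
  | insert a s ha ih =>
    obtain ⟨g, hg, h⟩ := ih
    have key : ∃ g' ∈ polyMap ι R, ∀ n : ι → ℕ, g' (fun j => (n j : ℂ)) =
        (conjLin (F a) ^ n a) (g (fun j => (n j : ℂ))) := by
      refine polyMap_induction (P := fun g => ∃ g' ∈ polyMap ι R, ∀ n : ι → ℕ,
        g' (fun j => (n j : ℂ)) = (conjLin (F a) ^ n a) (g (fun j => (n j : ℂ)))) ?_ ?_ ?_ hg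
      · intro p v
        obtain ⟨q, hq, hq'⟩ := exists_poly_conj_pow (F a) (hN a) a v
        refine ⟨fun x => MvPolynomial.eval x p • q x, ?_, fun n => by simp only [hq', map_smul]⟩
        have := mul_mem_polyMap (smul_mem_polyMap p (1 : R)) hq
        simpa using! this
      · exact ⟨0, (polyMap ι R).zero_mem, by simp⟩
      · rintro g₁ g₂ ⟨q₁, h₁, h₁'⟩ ⟨q₂, h₂, h₂'⟩
        exact ⟨q₁ + q₂, (polyMap ι R).add_mem h₁ h₂, fun n => by simp [h₁', h₂']⟩
    obtain ⟨g', hg', h'⟩ := key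
    refine ⟨g', hg', fun n => ?_⟩
    rw [h', h, Finset.noncommProd_insert_of_notMem _ _ _ _ ha, conjLin_mul, conjLin_pow]
    rfl

theorem exists_isTwistFamily [Fintype ι] (F : ι → Rˣ) (hF : ∀ i j, Commute (F i) (F j))
    (hN : ∀ i r, ∃ N, (fun t => (F i : R) * t - t * F i)^[N] r = 0) :
    ∃ Θ : (ι → ℂ) → R ≃ₐ[ℂ] R, IsTwistFamily F hF Θ := by
  choose θ hθ hθn using exists_poly_conj F hF hN
  have hadd : ∀ x r s, θ (r + s) x = θ r x + θ s x := fun x r s =>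
    polyMap_ext (hθ (r + s)) ((polyMap ι R).add_mem (hθ r) (hθ s))
      (fun n => by simp [hθn]) x
  have hsmul : ∀ x (c : ℂ) r, θ (c • r) x = c • θ r x := fun x c r =>
    polyMap_ext (hθ (c • r)) ((polyMap ι R).smul_mem c (hθ r)) (fun n => by simp [hθn]) x
  have hmul : ∀ x r s, θ (r * s) x = θ r x * θ s x := fun x r s =>
    polyMap_ext (hθ (r * s)) (mul_mem_polyMap (hθ r) (hθ s))
      (fun n => by simp [hθn, conjLin_apply, mul_assoc]) x
  have hone : ∀ x, θ 1 x = 1 := fun x =>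
    polyMap_ext (hθ 1) (const_mem_polyMap 1) (fun n => by simp [hθn, conjLin_apply]) x
  let T : (ι → ℂ) → R →ₐ[ℂ] R := fun x => AlgHom.ofLinearMap
    { toFun := fun r => θ r x, map_add' := hadd x, map_smul' := hsmul x } (hone x) (hmul x)
  have hT : ∀ x r, T x r = θ r x := fun _ _ => rfl
  -- composition with natural powers on the left
  have hshift : ∀ (b : ι → ℕ) (x : ι → ℂ) (r : R), T (fun i => x i + b i) r =
      conjLin (unitMonomial F hF fun i => (b i : ℤ)) (T x r) := by
    intro b x r
    have h1 := comp_mem_polyMap (fun i => MvPolynomial.X i + MvPolynomial.C (b i : ℂ)) (hθ r)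
    simp only [map_add, MvPolynomial.eval_X, MvPolynomial.eval_C] at h1
    refine polyMap_ext h1
      (map_mem_polyMap (conjLin (unitMonomial F hF fun i => (b i : ℤ))) (hθ r)) ?_ x
    intro n
    have h2 := hθn r (fun i => n i + b i)
    push_cast at h2
    rw [h2, hθn, ← Module.End.mul_apply, ← conjLin_mul, ← unitMonomial_add]
    congr 3
    ext i; simp [add_comm]
  have hint : ∀ (n : ι → ℤ) (r : R), T (fun i => (n i : ℂ)) r =
      conjLin (unitMonomial F hF n) r := by
    intro n r
    let b : ι → ℕ := fun i => (n i).natAbs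
    let a : ι → ℕ := fun i => (n i + b i).toNat
    have hab : ∀ i, (a i : ℤ) = n i + b i := fun i => Int.toNat_of_nonneg (by
      have : -n i ≤ |n i| := neg_le_abs _
      simp only [b, Int.natCast_natAbs]; linarith)
    have h1 := hshift b (fun i => (n i : ℂ)) r
    have h2 : (fun i => (n i : ℂ) + (b i : ℂ)) = fun i => (a i : ℂ) := by
      ext i; exact_mod_cast (hab i).symm
    rw [h2, hT, hθn] at h1
    have h3 := congrArg (conjLin (unitMonomial F hF fun i => (b i : ℤ))⁻¹) h1
    rw [← Module.End.mul_apply, ← Module.End.mul_apply, ← conjLin_mul, ← conjLin_mul,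
      inv_mul_cancel, conjLin_one, Module.End.one_apply] at h3
    rw [← h3, ← unitMonomial_neg, ← unitMonomial_add]
    congr 3
    ext i
    simp [hab i]
  have hinv : ∀ x r, T x (T (-x) r) = r := by
    intro x r
    have h1 := comp_mem_polyMap (fun i => -MvPolynomial.X i) (hθ r)
    simp only [map_neg, MvPolynomial.eval_X] at h1
    refine polyMap_ext (apply_mem_polyMap (T := fun x => (T x).toLinearMap) (fun v => hθ v) h1)
      (const_mem_polyMap r) ?_ x
    intro n
    have h2 := hint (fun i => -(n i : ℤ)) r
    have h3 := hint (fun i => (n i : ℤ))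
    push_cast at h2 h3
    simp only [AlgHom.toLinearMap_apply, ← hT, h2, h3]
    rw [← Module.End.mul_apply, ← conjLin_mul, ← unitMonomial_add]
    have : ((fun i => (n i : ℤ)) + fun i => -(n i : ℤ)) = -0 := by ext i; simp
    rw [this]
    have h0 := unitMonomial_neg F hF 0
    have h0' := unitMonomial_add F hF 0 0
    simp only [add_zero, left_eq_mul] at h0'
    rw [h0, h0', inv_one, conjLin_one]; rfl
  refine ⟨fun x => AlgEquiv.ofAlgHom (T x) (T (-x)) ?_ ?_, ?_, ?_⟩
  · ext r; exact hinv x r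
  · ext r; simpa using hinv (-x) r
  · intro n r
    rw [← conjLin_apply]
    exact hint n r
  · intro r
    exact hθ r

end Twist

section Roots

variable {g : Type u} [LieRing g] [LieAlgebra ℂ g]

/-- `α ∈ H*` is a root of `(g, H)`: it is nonzero and the space of root vectors
`{x ∈ g | [h, x] = α(h) x for all h ∈ H}` is nonzero. -/
def IsRoot (H : LieSubalgebra ℂ g) (α : Module.Dual ℂ H) : Prop :=
  α ≠ 0 ∧ LieModule.weightSpace g (α : H → ℂ) ≠ ⊥

/-- A commuting set of roots: a (necessarily finite) set `Γ` of roots such that `α + β` is neither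
a root nor zero for `α, β ∈ Γ`, together with a choice, for each `γ ∈ Γ`, of a nonzero vector `f γ`
in the root space of `-γ`. -/
structure CommutingSet (H : LieSubalgebra ℂ g) where
  /-- The underlying set of roots. -/
  roots : Finset (Module.Dual ℂ H)
  isRoot : ∀ γ ∈ roots, IsRoot H γ
  add_not_isRoot : ∀ α ∈ roots, ∀ β ∈ roots, ¬ IsRoot H (α + β)
  add_ne_zero : ∀ α ∈ roots, ∀ β ∈ roots, α + β ≠ 0
  /-- The chosen root vectors. -/
  f : roots → g
  f_mem : ∀ γ : roots, f γ ∈ LieModule.weightSpace g ((-(γ : Module.Dual ℂ H) : Module.Dual ℂ H) : H → ℂ)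
  f_ne_zero : ∀ γ, f γ ≠ 0

variable {H : LieSubalgebra ℂ g}

theorem exists_ne_zero_iff {L M : Type*} [LieRing L] [LieAlgebra ℂ L] [AddCommGroup M] [Module ℂ M]
    [LieRingModule L M] (N : LieSubmodule ℂ L M) : N ≠ ⊥ ↔ ∃ x ∈ N, x ≠ 0 := by
  rw [Ne, LieSubmodule.eq_bot_iff]; push Not; rfl

/-- The roots of a reductive Lie algebra are stable under negation. -/
theorem IsRoot.neg [FiniteDimensional ℂ g] [LieAlgebra.HasCentralRadical ℂ g] [H.IsCartanSubalgebra]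
    {α : Module.Dual ℂ H} (hα : IsRoot H α) : IsRoot H (-α) := by
  obtain ⟨h0, hα⟩ := hα
  refine ⟨neg_ne_zero.2 h0, ?_⟩
  obtain ⟨x, hx, hx0⟩ := (exists_ne_zero_iff (LieModule.weightSpace g (α : H → ℂ))).1 hα
  have hgen : LieModule.genWeightSpace g (-(α : H → ℂ)) ≠ ⊥ := by
    intro hbot
    have hk : x ∈ LieIdeal.killingCompl ℂ g ⊤ := by
      rw [LieIdeal.mem_killingCompl]
      intro y _
      rw [LieModule.traceForm_comm]
      have hy : y ∈ ⨆ χ : LieModule.Weight ℂ H g, LieModule.genWeightSpace g χ := by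
        rw [LieModule.iSup_genWeightSpace_eq_top' ℂ H g]; trivial
      induction hy using LieSubmodule.iSup_induction' with
      | mem χ y hy =>
        refine LieAlgebra.killingForm_apply_eq_zero_of_mem_rootSpace_of_add_ne_zero ℂ g H
          (LieModule.weightSpace_le_genWeightSpace g _ hx) hy ?_
        intro h
        have : (χ : H → ℂ) = -(α : H → ℂ) := eq_neg_of_add_eq_zero_right h
        have h5 : LieModule.genWeightSpace g (χ : H → ℂ) = ⊥ := by rw [this]; exact hbot
        exact χ.genWeightSpace_ne_bot' h5
      | zero => simp
      | add y z _ _ hy hz => rw [map_add, hy trivial, hz trivial, add_zero]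
    have hc := LieAlgebra.killingCompl_top_le_radical ℂ g hk
    rw [LieAlgebra.radical_eq_center] at hc
    apply h0
    ext h
    have h1 := (LieModule.mem_weightSpace _ _).1 hx h
    have h2 : ⁅(h : g), x⁆ = 0 := (LieModule.mem_maxTrivSubmodule ℂ g g x).1 hc h
    have h3 : α h • x = 0 := h1.symm.trans h2
    simpa [hx0] using h3
  obtain ⟨m, hm0, hm⟩ := LieModule.exists_forall_lie_eq_smul ℂ H g ⟨_, hgen⟩
  rw [exists_ne_zero_iff]
  exact ⟨m, (LieModule.mem_weightSpace _ _).2 fun h => by simpa using hm h, hm0⟩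

namespace CommutingSet

variable (Γ : CommutingSet H)

theorem lie_f (h : H) (γ : Γ.roots) :
    ⁅(h : g), Γ.f γ⁆ = -((γ : Module.Dual ℂ H) h • Γ.f γ) := by
  have := (LieModule.mem_weightSpace _ _).1 (Γ.f_mem γ) h
  simpa using! this

theorem isNilpotent_ad [FiniteDimensional ℂ g] [H.IsCartanSubalgebra] (γ : Γ.roots) :
    IsNilpotent (LieAlgebra.ad ℂ g (Γ.f γ)) := by
  refine LieAlgebra.isNilpotent_ad_of_mem_rootSpace H ?_
    (LieModule.weightSpace_le_genWeightSpace g _ (Γ.f_mem γ))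
  intro h
  have h1 := (Γ.isRoot γ γ.2).1
  apply h1
  ext x
  have := congrFun h x
  simpa using this

theorem lie_f_f [FiniteDimensional ℂ g] [LieAlgebra.HasCentralRadical ℂ g]
    [H.IsCartanSubalgebra] (γ δ : Γ.roots) :
    ⁅Γ.f γ, Γ.f δ⁆ = 0 := by
  by_contra hne
  refine Γ.add_not_isRoot γ γ.2 δ δ.2 ?_
  have key : IsRoot H (-((γ : Module.Dual ℂ H) + δ)) := by
    refine ⟨neg_ne_zero.2 (Γ.add_ne_zero γ γ.2 δ δ.2), ?_⟩
    rw [exists_ne_zero_iff]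
    refine ⟨_, (LieModule.mem_weightSpace _ _).2 fun h => ?_, hne⟩
    change ⁅(h : g), ⁅Γ.f γ, Γ.f δ⁆⁆ = _
    rw [leibniz_lie, Γ.lie_f, Γ.lie_f]
    simp [add_smul]
    abel
  simpa using key.neg

end CommutingSet

end Roots


open CategoryTheory

section Localization

variable {g : Type u} [LieRing g] [LieAlgebra ℂ g] {H : LieSubalgebra ℂ g}

namespace CommutingSet

variable (Γ : CommutingSet H)

/-- The element `f γ` of the universal enveloping algebra `U(g)`. -/
noncomputable def rootVec (γ : Γ.roots) : UniversalEnvelopingAlgebra ℂ g :=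
  UniversalEnvelopingAlgebra.ι ℂ (Γ.f γ)

/-- The multiplicative subset of `U(g)` generated by the `f γ`, `γ ∈ Γ`. -/
def multSet : Submonoid (UniversalEnvelopingAlgebra ℂ g) :=
  Submonoid.closure (Set.range Γ.rootVec)

variable [FiniteDimensional ℂ g] [LieAlgebra.HasCentralRadical ℂ g] [H.IsCartanSubalgebra]

/-- The multiplicative subset generated by the `f γ` satisfies the Ore condition. -/
noncomputable instance : OreLocalization.OreSet Γ.multSet :=
  (nonempty_oreSet Γ.rootVec fun γ r =>
    enveloping_locally_nilpotent (Γ.isNilpotent_ad γ) r).some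

/-- The localization `U_Γ` of `U(g)` relative to the multiplicative subset generated by
the `f γ`, `γ ∈ Γ`. -/
abbrev Loc : Type u := OreLocalization Γ.multSet (UniversalEnvelopingAlgebra ℂ g)

/-- The localization map `U(g) → U_Γ`. -/
noncomputable def toLoc : UniversalEnvelopingAlgebra ℂ g →ₐ[ℂ] Γ.Loc :=
  { OreLocalization.numeratorRingHom with commutes' := fun _ => rfl }

/-- The unit `f γ` of `U_Γ`. -/
noncomputable def rootUnit (γ : Γ.roots) : Γ.Locˣ :=
  OreLocalization.numeratorUnit ⟨Γ.rootVec γ, Submonoid.subset_closure ⟨γ, rfl⟩⟩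

set_option linter.unusedSectionVars false in
theorem coe_rootUnit (γ : Γ.roots) : (Γ.rootUnit γ : Γ.Loc) = Γ.toLoc (Γ.rootVec γ) := rfl

section
attribute [local instance 100] LieRing.ofAssociativeRing

theorem rootVec_commute (γ δ : Γ.roots) : Commute (Γ.rootVec γ) (Γ.rootVec δ) := by
  have h := LieHom.map_lie (UniversalEnvelopingAlgebra.ι ℂ) (Γ.f γ) (Γ.f δ)
  rw [Γ.lie_f_f, map_zero, LieRing.of_associative_ring_bracket] at h
  exact sub_eq_zero.1 h.symm

set_option linter.unusedSectionVars false in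
theorem ι_mul_rootVec (h : H) (γ : Γ.roots) :
    UniversalEnvelopingAlgebra.ι ℂ (h : g) * Γ.rootVec γ =
      Γ.rootVec γ * UniversalEnvelopingAlgebra.ι ℂ (h : g)
        - (γ : Module.Dual ℂ H) h • Γ.rootVec γ := by
  have h1 := LieHom.map_lie (UniversalEnvelopingAlgebra.ι ℂ) (h : g) (Γ.f γ)
  rw [Γ.lie_f, map_neg, map_smul, LieRing.of_associative_ring_bracket] at h1
  change -(_ • Γ.rootVec γ) = _ * Γ.rootVec γ - Γ.rootVec γ * _ at h1
  rw [eq_sub_iff_add_eq] at h1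
  rw [← h1]; abel
end

theorem rootUnit_commute (γ δ : Γ.roots) : Commute (Γ.rootUnit γ) (Γ.rootUnit δ) := by
  apply Units.ext
  simp only [Units.val_mul, coe_rootUnit, ← map_mul, (Γ.rootVec_commute γ δ).eq]

theorem multSet_commute (γ : Γ.roots) (s : Γ.multSet) :
    Commute (Γ.rootVec γ) (s : UniversalEnvelopingAlgebra ℂ g) := by
  obtain ⟨s, hs⟩ := s
  induction hs using Submonoid.closure_induction with
  | mem s hs => obtain ⟨δ, rfl⟩ := hs; exact Γ.rootVec_commute γ δ
  | one => exact Commute.one_right _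
  | mul a b _ _ ha hb => exact Commute.mul_right ha hb

theorem loc_locally_nilpotent (γ : Γ.roots) (r : Γ.Loc) :
    ∃ N, (fun t => (Γ.rootUnit γ : Γ.Loc) * t - t * Γ.rootUnit γ)^[N] r = 0 := by
  induction r using OreLocalization.ind with
  | _ a s =>
    obtain ⟨N, hN⟩ := enveloping_locally_nilpotent (Γ.isNilpotent_ad γ) a
    refine ⟨N, ?_⟩
    have hs : ∀ b : UniversalEnvelopingAlgebra ℂ g, OreLocalization.oreDiv b s =
        ((OreLocalization.numeratorUnit s)⁻¹ : Γ.Locˣ) * Γ.toLoc b := by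
      intro b
      have h1 := OreLocalization.one_div_mul (r := b) (s := 1) (t := s)
      rw [one_mul] at h1
      exact h1.symm
    have hc : Commute (Γ.rootUnit γ) (OreLocalization.numeratorUnit s)⁻¹ := by
      apply Commute.inv_right
      apply Units.ext
      have := congrArg Γ.toLoc (Γ.multSet_commute γ s).eq
      rw [map_mul, map_mul] at this
      exact this
    have hc' := congrArg Units.val hc.eq
    rw [Units.val_mul, Units.val_mul, coe_rootUnit] at hc'
    have key : ∀ (n : ℕ) (b : UniversalEnvelopingAlgebra ℂ g),
        (fun t => (Γ.rootUnit γ : Γ.Loc) * t - t * Γ.rootUnit γ)^[n] (OreLocalization.oreDiv b s) =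
        OreLocalization.oreDiv ((fun t => Γ.rootVec γ * t - t * Γ.rootVec γ)^[n] b) s := by
      intro n
      induction n with
      | zero => intro b; rfl
      | succ n ih =>
        intro b
        rw [Function.iterate_succ_apply, Function.iterate_succ_apply, ← ih]
        congr 1
        rw [hs, hs, map_sub, map_mul, map_mul, mul_sub, coe_rootUnit, ← mul_assoc, hc',
          mul_assoc, mul_assoc]
    rw [key]
    change OreLocalization.oreDiv ((fun t => Γ.rootVec γ * t - t * Γ.rootVec γ)^[N] a) s = 0
    have hN' : (fun t => Γ.rootVec γ * t - t * Γ.rootVec γ)^[N] a = 0 := hN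
    rw [hN', hs, map_zero, mul_zero]

theorem exists_theta : ∃ Θ : (Γ.roots → ℂ) → Γ.Loc ≃ₐ[ℂ] Γ.Loc,
    IsTwistFamily Γ.rootUnit Γ.rootUnit_commute Θ :=
  exists_isTwistFamily _ _ Γ.loc_locally_nilpotent

/-- The automorphism `Θ_x` of `U_Γ` for `x ∈ ℂ^Γ`: the conjugation by `∏ γ, (f γ) ^ x γ` for integral
`x`, extended to all complex `x` by the requirement that `Θ_x(u)` be polynomial in `x`. -/
noncomputable def theta : (Γ.roots → ℂ) → Γ.Loc ≃ₐ[ℂ] Γ.Loc := Γ.exists_theta.choose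

theorem isTwistFamily_theta : IsTwistFamily Γ.rootUnit Γ.rootUnit_commute Γ.theta :=
  Γ.exists_theta.choose_spec

/-- The family of automorphisms is determined by its characterization. -/
theorem eq_theta {Θ : (Γ.roots → ℂ) → Γ.Loc ≃ₐ[ℂ] Γ.Loc}
    (hΘ : IsTwistFamily Γ.rootUnit Γ.rootUnit_commute Θ) : Θ = Γ.theta := by
  funext x
  ext r
  refine polyMap_ext (hΘ.poly r) (Γ.isTwistFamily_theta.poly r) (fun n => ?_) x
  have h1 := hΘ.conj (fun i => n i) r
  have h2 := Γ.isTwistFamily_theta.conj (fun i => n i) r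
  push_cast at h1 h2
  rw [h1, h2]

theorem theta_rootVec (x : Γ.roots → ℂ) (γ : Γ.roots) :
    Γ.theta x (Γ.toLoc (Γ.rootVec γ)) = Γ.toLoc (Γ.rootVec γ) := by
  refine polyMap_ext (Γ.isTwistFamily_theta.poly _) (const_mem_polyMap _) (fun n => ?_) x
  have h2 := Γ.isTwistFamily_theta.conj (fun i => n i) (Γ.toLoc (Γ.rootVec γ))
  push_cast at h2
  rw [h2, ← coe_rootUnit, ← Units.val_mul, ← Units.val_mul,
    ← (unitMonomial_commute Γ.rootUnit Γ.rootUnit_commute _ γ).eq]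
  simp

/-- The linear form `ν = ∑ γ, x γ • γ` on `H`. -/
def weightOf (x : Γ.roots → ℂ) : Module.Dual ℂ H :=
  ∑ γ, x γ • (γ : Module.Dual ℂ H)

set_option linter.unusedSectionVars false in
theorem weightOf_lie (x : Γ.roots → ℂ) (a b : H) : Γ.weightOf x ⁅a, b⁆ = 0 := by
  have : ∀ γ : Γ.roots, (γ : Module.Dual ℂ H) ⁅a, b⁆ = 0 := by
    intro γ
    have h1 := Γ.lie_f ⁅a, b⁆ γ
    rw [LieSubalgebra.coe_bracket, lie_lie, Γ.lie_f, Γ.lie_f] at h1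
    simp only [lie_neg, lie_smul, Γ.lie_f, smul_neg, neg_neg, smul_smul] at h1
    rw [mul_comm, sub_self] at h1
    have h2 := neg_eq_zero.1 h1.symm
    exact (smul_eq_zero.1 h2).resolve_right (Γ.f_ne_zero γ)
  simp [weightOf, this]

theorem conj_ι (n : Γ.roots → ℕ) (h : H) (s : Finset Γ.roots)
    (hc : (s : Set Γ.roots).Pairwise (Function.onFun Commute fun γ => Γ.rootUnit γ ^ (n γ : ℤ))) :
    conjLin (s.noncommProd (fun γ => Γ.rootUnit γ ^ (n γ : ℤ)) hc)
      (Γ.toLoc (UniversalEnvelopingAlgebra.ι ℂ (h : g))) =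
    Γ.toLoc (UniversalEnvelopingAlgebra.ι ℂ (h : g)) +
      algebraMap ℂ Γ.Loc (∑ γ ∈ s, (n γ : ℂ) * (γ : Module.Dual ℂ H) h) := by
  have hone : ∀ (γ : Γ.roots) (c : ℂ), conjLin (Γ.rootUnit γ)
      (Γ.toLoc (UniversalEnvelopingAlgebra.ι ℂ (h : g)) + algebraMap ℂ Γ.Loc c) =
      Γ.toLoc (UniversalEnvelopingAlgebra.ι ℂ (h : g)) +
        algebraMap ℂ Γ.Loc (c + (γ : Module.Dual ℂ H) h) := by
    intro γ c
    rw [conjLin_apply, Units.mul_inv_eq_iff_eq_mul, coe_rootUnit]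
    have := congrArg Γ.toLoc (Γ.ι_mul_rootVec h γ)
    rw [map_mul, map_sub, map_mul, map_smul] at this
    rw [add_mul, this, mul_add, ← Algebra.commutes, map_add, add_mul,
      Algebra.smul_def ((γ : Module.Dual ℂ H) h)]
    abel
  have hpow : ∀ (γ : Γ.roots) (k : ℕ) (c : ℂ), conjLin (Γ.rootUnit γ ^ k)
      (Γ.toLoc (UniversalEnvelopingAlgebra.ι ℂ (h : g)) + algebraMap ℂ Γ.Loc c) =
      Γ.toLoc (UniversalEnvelopingAlgebra.ι ℂ (h : g)) +
        algebraMap ℂ Γ.Loc (c + k * (γ : Module.Dual ℂ H) h) := by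
    intro γ k
    induction k with
    | zero => intro c; simp [conjLin_one]
    | succ k ih =>
      intro c
      rw [pow_succ, conjLin_mul, Module.End.mul_apply, hone, ih]
      congr 2; push_cast; ring
  classical
  induction s using Finset.induction_on with
  | empty => rw [Finset.noncommProd_empty, conjLin_one]; simp
  | insert a s ha ih =>
    rw [Finset.noncommProd_insert_of_notMem _ _ _ _ ha, conjLin_mul, Module.End.mul_apply, ih,
      zpow_natCast, hpow, Finset.sum_insert ha, add_comm (_ * _)]

/-- `Θ_x` shifts `h ∈ H` by the scalar `ν(h)`, where `ν = ∑ γ, x γ • γ`. -/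
theorem theta_ι (x : Γ.roots → ℂ) (h : H) :
    Γ.theta x (Γ.toLoc (UniversalEnvelopingAlgebra.ι ℂ (h : g))) =
      Γ.toLoc (UniversalEnvelopingAlgebra.ι ℂ (h : g)) +
        algebraMap ℂ Γ.Loc (Γ.weightOf x h) := by
  have hp : (fun x : Γ.roots → ℂ => Γ.toLoc (UniversalEnvelopingAlgebra.ι ℂ (h : g)) +
        algebraMap ℂ Γ.Loc (Γ.weightOf x h)) ∈ polyMap Γ.roots Γ.Loc := by
    refine (polyMap Γ.roots Γ.Loc).add_mem (const_mem_polyMap _) ?_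
    have := smul_mem_polyMap (∑ γ : Γ.roots, MvPolynomial.X γ *
      MvPolynomial.C ((γ : Module.Dual ℂ H) h)) (1 : Γ.Loc)
    simpa [weightOf, Algebra.algebraMap_eq_smul_one, Finset.sum_smul] using! this
  refine polyMap_ext (Γ.isTwistFamily_theta.poly _) hp (fun n => ?_) x
  have h2 := Γ.isTwistFamily_theta.conj (fun i => n i)
    (Γ.toLoc (UniversalEnvelopingAlgebra.ι ℂ (h : g)))
  push_cast at h2
  rw [h2, ← conjLin_apply, unitMonomial, conj_ι]
  simp [weightOf]

end CommutingSet

end Localization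


open scoped ModuleCat

section Category

/-- Modules over a complex algebra `A` that are semisimple and locally finite: every vector
generates a finite-dimensional submodule. -/
def locFinSemisimple (A : Type u) [Ring A] [Algebra ℂ A] : ObjectProperty (ModuleCat.{u} A) :=
  fun N => IsSemisimpleModule A N ∧ ∀ v : N, FiniteDimensional ℂ (Submodule.span A {v})

theorem finite_span_of_surjective {A B N N' : Type*} [Ring A] [Algebra ℂ A] [Ring B] [Algebra ℂ B]
    [AddCommGroup N] [Module A N] [Module ℂ N] [IsScalarTower ℂ A N]
    [AddCommGroup N'] [Module B N'] [Module ℂ N'] [IsScalarTower ℂ B N']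
    (σ : A →ₐ[ℂ] B) (hσ : Function.Surjective σ) (l : N →+ N')
    (hl : ∀ (a : A) (v : N), l (a • v) = σ a • l v) (v : N)
    (h : FiniteDimensional ℂ (Submodule.span A {v})) :
    FiniteDimensional ℂ (Submodule.span B {l v}) := by
  have hmem : ∀ w ∈ Submodule.span A {v}, l w ∈ Submodule.span B {l v} := by
    intro w hw
    obtain ⟨a, rfl⟩ := Submodule.mem_span_singleton.1 hw
    rw [hl]
    exact Submodule.smul_mem _ _ (Submodule.mem_span_singleton_self _)
  have hC : ∀ (c : ℂ) (w : N), l (c • w) = c • l w := by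
    intro c w
    rw [← algebraMap_smul A c w, hl, AlgHom.commutes, algebraMap_smul]
  let F : Submodule.span A {v} →ₗ[ℂ] Submodule.span B {l v} :=
    { toFun := fun w => ⟨l w, hmem w w.2⟩
      map_add' := fun w w' => Subtype.ext (by simp)
      map_smul' := fun c w => Subtype.ext (by simpa using! hC c w) }
  refine Module.Finite.of_surjective F ?_
  rintro ⟨w, hw⟩
  obtain ⟨b, rfl⟩ := Submodule.mem_span_singleton.1 hw
  obtain ⟨a, rfl⟩ := hσ b
  exact ⟨⟨a • v, Submodule.smul_mem _ _ (Submodule.mem_span_singleton_self _)⟩,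
    Subtype.ext (hl a v)⟩

theorem locFinSemisimple_of_injective_pi {A : Type u} [Ring A] [Algebra ℂ A] {J : Type} [Finite J]
    {N : ModuleCat.{u} A} {N' : J → ModuleCat.{u} A} (f : ∀ j, N ⟶ N' j)
    (hf : ∀ v : N, (∀ j, f j v = 0) → v = 0) (h : ∀ j, locFinSemisimple A (N' j)) :
    locFinSemisimple A N := by
  refine ⟨?_, fun v => ?_⟩
  · have : ∀ j, IsSemisimpleModule A (N' j) := fun j => (h j).1
    refine IsSemisimpleModule.of_injective (LinearMap.pi fun j => (f j).hom) ?_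
    rw [injective_iff_map_eq_zero]
    intro v hv
    exact hf v fun j => congrFun hv j
  · have : ∀ j, FiniteDimensional ℂ (Submodule.span A {f j v}) := fun j => (h j).2 _
    have hmem : ∀ j, ∀ w ∈ Submodule.span A {v}, f j w ∈ Submodule.span A {f j v} := by
      intro j w hw
      obtain ⟨a, rfl⟩ := Submodule.mem_span_singleton.1 hw
      rw [map_smul]
      exact Submodule.smul_mem _ _ (Submodule.mem_span_singleton_self _)
    let F : Submodule.span A {v} →ₗ[ℂ] ((j : J) → Submodule.span A {f j v}) :=
      LinearMap.pi fun j =>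
        (((f j).hom.restrict (hmem j)).restrictScalars ℂ)
    refine Module.Finite.of_injective F ?_
    rw [injective_iff_map_eq_zero]
    intro w hw
    refine Subtype.ext (hf w fun j => ?_)
    exact congrArg Subtype.val (congrFun hw j)

theorem locFinSemisimple_of_surjective {A : Type u} [Ring A] [Algebra ℂ A]
    {N N' : ModuleCat.{u} A} (f : N ⟶ N') (hf : Function.Surjective f)
    (h : locFinSemisimple A N) : locFinSemisimple A N' := by
  have := h.1
  refine ⟨IsSemisimpleModule.of_surjective f.hom hf, fun v => ?_⟩
  obtain ⟨w, rfl⟩ := hf v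
  exact finite_span_of_surjective (AlgHom.id ℂ A) Function.surjective_id f.hom.toAddMonoidHom
    (fun a v => map_smul f.hom a v) w (h.2 w)

variable {g : Type u} [LieRing g] [LieAlgebra ℂ g]

section
attribute [local instance 100] LieRing.ofAssociativeRing

/-- The algebra homomorphism `U(H) → U(g)` induced by the inclusion `H ⊆ g`. -/
noncomputable def envelopingIncl (H : LieSubalgebra ℂ g) :
    UniversalEnvelopingAlgebra ℂ H →ₐ[ℂ] UniversalEnvelopingAlgebra ℂ g :=
  UniversalEnvelopingAlgebra.lift ℂ ((UniversalEnvelopingAlgebra.ι ℂ).comp H.incl)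

theorem envelopingIncl_ι (H : LieSubalgebra ℂ g) (h : H) :
    envelopingIncl H (UniversalEnvelopingAlgebra.ι ℂ h) =
      UniversalEnvelopingAlgebra.ι ℂ (h : g) := by
  exact UniversalEnvelopingAlgebra.lift_ι_apply ℂ
    ((UniversalEnvelopingAlgebra.ι ℂ).comp H.incl) h

/-- The automorphism of `U(H)` given by `h ↦ h + μ(h)`, for a linear form `μ` vanishing on
brackets. -/
noncomputable def shiftHom {A : Type u} [LieRing A] [LieAlgebra ℂ A] (μ : Module.Dual ℂ A)
    (hμ : ∀ a b : A, μ ⁅a, b⁆ = 0) :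
    UniversalEnvelopingAlgebra ℂ A →ₐ[ℂ] UniversalEnvelopingAlgebra ℂ A :=
  UniversalEnvelopingAlgebra.lift ℂ
    { toFun := fun a => UniversalEnvelopingAlgebra.ι ℂ a + algebraMap ℂ _ (μ a)
      map_add' := fun a b => by simp only [map_add]; abel
      map_smul' := fun c a => by
        simp only [map_smul, smul_eq_mul, map_mul, RingHom.id_apply, Algebra.smul_def, mul_add]
      map_lie' := fun {a b} => by
        simp only [hμ, map_zero, add_zero, LieHom.map_lie, LieRing.of_associative_ring_bracket]
        have h1 := Algebra.commutes (μ a) (UniversalEnvelopingAlgebra.ι ℂ b)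
        have h2 := Algebra.commutes (μ b) (UniversalEnvelopingAlgebra.ι ℂ a)
        have h3 := Algebra.commutes (μ a)
          (algebraMap ℂ (UniversalEnvelopingAlgebra ℂ A) (μ b))
        rw [add_mul, mul_add, mul_add, add_mul, mul_add, mul_add, h1, h2, h3]
        abel }

theorem shiftHom_ι {A : Type u} [LieRing A] [LieAlgebra ℂ A] (μ : Module.Dual ℂ A)
    (hμ : ∀ a b : A, μ ⁅a, b⁆ = 0) (a : A) :
    shiftHom μ hμ (UniversalEnvelopingAlgebra.ι ℂ a) =
      UniversalEnvelopingAlgebra.ι ℂ a + algebraMap ℂ _ (μ a) := by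
  rw [shiftHom, UniversalEnvelopingAlgebra.lift_ι_apply]
  rfl

theorem shiftHom_neg {A : Type u} [LieRing A] [LieAlgebra ℂ A] (μ : Module.Dual ℂ A)
    (hμ : ∀ a b : A, μ ⁅a, b⁆ = 0) (hμ' : ∀ a b : A, (-μ) ⁅a, b⁆ = 0)
    (y : UniversalEnvelopingAlgebra ℂ A) : shiftHom μ hμ (shiftHom (-μ) hμ' y) = y := by
  have key : (shiftHom μ hμ).comp (shiftHom (-μ) hμ') = AlgHom.id ℂ _ := by
    apply UniversalEnvelopingAlgebra.hom_ext
    refine LieHom.ext fun a => ?_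
    change shiftHom μ hμ (shiftHom (-μ) hμ' (UniversalEnvelopingAlgebra.ι ℂ a)) =
      UniversalEnvelopingAlgebra.ι ℂ a
    rw [shiftHom_ι, map_add, shiftHom_ι, AlgHom.commutes, add_assoc, ← map_add]
    simp
  exact DFunLike.congr_fun key y

theorem shiftHom_neg' {A : Type u} [LieRing A] [LieAlgebra ℂ A] (μ : Module.Dual ℂ A)
    (hμ : ∀ a b : A, μ ⁅a, b⁆ = 0) (hμ' : ∀ a b : A, (-μ) ⁅a, b⁆ = 0)
    (y : UniversalEnvelopingAlgebra ℂ A) : shiftHom (-μ) hμ' (shiftHom μ hμ y) = y := by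
  have := shiftHom_neg (-μ) hμ' (by simpa using hμ) y
  simpa using this
end

/-- A `g`-module is a `(g, H)`-module if its restriction to `H` is locally finite
and semisimple. -/
def isGHModule (H : LieSubalgebra ℂ g) :
    ObjectProperty (ModuleCat.{u} (UniversalEnvelopingAlgebra ℂ g)) :=
  fun M => locFinSemisimple (UniversalEnvelopingAlgebra ℂ H)
    ((ModuleCat.restrictScalars (envelopingIncl H).toRingHom).obj M)

/-- The category of `(g, H)`-modules. -/
abbrev GHMod (H : LieSubalgebra ℂ g) := (isGHModule H).FullSubcategory

variable (H : LieSubalgebra ℂ g)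

instance : (isGHModule H).IsClosedUnderSubobjects where
  prop_of_mono f _ hY :=
    locFinSemisimple_of_injective_pi (J := Unit)
      (fun _ => (ModuleCat.restrictScalars (envelopingIncl H).toRingHom).map f)
      (fun v hv => (injective_iff_map_eq_zero f.hom).1 ((ModuleCat.mono_iff_injective f).1
        inferInstance) v (hv ())) fun _ => hY

instance : (isGHModule H).IsClosedUnderQuotients where
  prop_of_epi f _ hX :=
    locFinSemisimple_of_surjective
      ((ModuleCat.restrictScalars (envelopingIncl H).toRingHom).map f)
      ((ModuleCat.epi_iff_surjective f).1 inferInstance) hX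

instance : (isGHModule H).IsClosedUnderFiniteProducts where
  isClosedUnderLimitsOfShape J _ := ⟨by
    rintro X ⟨p⟩
    refine locFinSemisimple_of_injective_pi (J := J)
      (fun j => (ModuleCat.restrictScalars (envelopingIncl H).toRingHom).map (p.π.app ⟨j⟩))
      (fun v hv => ?_) fun j => p.prop_diag_obj ⟨j⟩
    refine Limits.Concrete.isLimit_ext _ p.isLimit v 0 fun j => ?_
    exact (hv j.as).trans (map_zero (p.π.app j).hom).symm⟩

instance : (isGHModule H).ContainsZero where
  exists_zero := ⟨ModuleCat.of _ PUnit, ModuleCat.isZero_of_subsingleton _,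
    locFinSemisimple_of_injective_pi (J := Empty) (N' := Empty.elim) (fun j => j.elim)
      (fun v _ => Subsingleton.elim (α := PUnit) v 0) fun j => j.elim⟩

/-- The groups `Ext` in the category of `(g, H)`-modules. -/
instance : HasExt.{u + 1} (GHMod H) := HasExt.standard _

end Category


section Twisting

variable {g : Type u} [LieRing g] [LieAlgebra ℂ g] {H : LieSubalgebra ℂ g}

namespace CommutingSet

variable (Γ : CommutingSet H)

/-- A `(g, H)`-module is `Γ`-bijective if every `f γ`, `γ ∈ Γ`, acts bijectively on it. -/
def isBijective : ObjectProperty (GHMod H) :=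
  fun M => ∀ γ : Γ.roots, Function.Bijective fun v : M.obj => Γ.rootVec γ • v

/-- The category `C_Γ` of `Γ`-bijective `(g, H)`-modules. -/
abbrev BijMod := Γ.isBijective.FullSubcategory

variable {Γ} in
theorem isUnit_multSet (M : Γ.BijMod) (s : Γ.multSet) :
    IsUnit (Algebra.lsmul ℂ ℂ M.obj.obj (s : UniversalEnvelopingAlgebra ℂ g)) := by
  obtain ⟨s, hs⟩ := s
  induction hs using Submonoid.closure_induction with
  | mem s hs => obtain ⟨γ, rfl⟩ := hs; exact (Module.End.isUnit_iff _).2 (M.property γ)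
  | one => simp
  | mul a b _ _ ha hb => simp only [map_mul]; exact IsUnit.mul ha hb

variable {Γ} in
/-- The elements of the multiplicative set as invertible operators on a `Γ`-bijective module. -/
noncomputable def multSetUnits (M : Γ.BijMod) : Γ.multSet →* (Module.End ℂ M.obj.obj)ˣ :=
  IsUnit.liftRight ((Algebra.lsmul ℂ ℂ M.obj.obj).toRingHom.toMonoidHom.comp Γ.multSet.subtype)
    (isUnit_multSet M)

variable {Γ} in
theorem coe_multSetUnits (M : Γ.BijMod) (s : Γ.multSet) :
    (Algebra.lsmul ℂ ℂ M.obj.obj).toRingHom (s : UniversalEnvelopingAlgebra ℂ g) =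
      multSetUnits M s :=
  (IsUnit.coe_liftRight
    ((Algebra.lsmul ℂ ℂ M.obj.obj).toRingHom.toMonoidHom.comp Γ.multSet.subtype)
    (isUnit_multSet M) s).symm

variable [FiniteDimensional ℂ g] [LieAlgebra.HasCentralRadical ℂ g] [H.IsCartanSubalgebra]

variable {Γ} in
/-- The action of `U_Γ` on a `Γ`-bijective module, extending that of `U(g)`. -/
noncomputable def locAction (M : Γ.BijMod) : Γ.Loc →+* Module.End ℂ M.obj.obj :=
  OreLocalization.universalHom (Algebra.lsmul ℂ ℂ M.obj.obj).toRingHom (multSetUnits M)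
    (coe_multSetUnits M)

variable {Γ} in
set_option linter.unusedSectionVars false in
theorem locAction_toLoc (M : Γ.BijMod) (a : UniversalEnvelopingAlgebra ℂ g) (v : M.obj.obj) :
    locAction M (Γ.toLoc a) v = a • v :=
  LinearMap.congr_fun (OreLocalization.universalHom_commutes
    (Algebra.lsmul ℂ ℂ M.obj.obj).toRingHom (multSetUnits M) (coe_multSetUnits M) (r := a)) v

variable {Γ} in
theorem locAction_map {M N : Γ.BijMod} (φ : M ⟶ N) (u : Γ.Loc) (v : M.obj.obj) :
    φ.hom.hom (locAction M u v) = locAction N u (φ.hom.hom v) := by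
  induction u using OreLocalization.ind with
  | _ a s =>
    have hs : Γ.toLoc s * OreLocalization.oreDiv a s = Γ.toLoc a := by
      have h1 := OreLocalization.one_div_mul (r := a) (s := 1) (t := s)
      rw [one_mul] at h1
      rw [← h1, ← mul_assoc]
      change ((OreLocalization.numeratorUnit s * (OreLocalization.numeratorUnit s)⁻¹ : Γ.Locˣ) :
        Γ.Loc) * Γ.toLoc a = _
      simp
    have hinj : Function.Injective fun w : N.obj.obj =>
        (s : UniversalEnvelopingAlgebra ℂ g) • w :=
      ((Module.End.isUnit_iff _).1 (isUnit_multSet N s)).1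
    apply hinj
    simp only
    rw [← map_smul, ← locAction_toLoc, ← locAction_toLoc, ← Module.End.mul_apply,
      ← Module.End.mul_apply, ← map_mul, ← map_mul, hs, locAction_toLoc, locAction_toLoc, map_smul]

/-- A `Γ`-bijective `(g, H)`-module, regarded as a module over `U_Γ`. -/
noncomputable def toLocModule : Γ.BijMod ⥤ ModuleCat.{u} Γ.Loc where
  obj M :=
    letI := Module.compHom M.obj.obj (locAction M)
    ModuleCat.of Γ.Loc M.obj.obj
  map {M N} φ :=
    letI := Module.compHom M.obj.obj (locAction M)
    letI := Module.compHom N.obj.obj (locAction N)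
    ModuleCat.ofHom
      { toFun := φ.hom.hom
        map_add' := map_add φ.hom.hom.hom
        map_smul' := fun u v => locAction_map φ u v }

/-- The `g`-module underlying the twist of a `Γ`-bijective module by `Θ_x`: an element `u` of `U_Γ`
acts on it by the original action of `Θ_x(u)`. -/
noncomputable def twistModule (x : Γ.roots → ℂ) :
    Γ.BijMod ⥤ ModuleCat.{u} (UniversalEnvelopingAlgebra ℂ g) :=
  Γ.toLocModule ⋙ ModuleCat.restrictScalars (Γ.theta x).toRingEquiv.toRingHom ⋙
    ModuleCat.restrictScalars Γ.toLoc.toRingHom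

/-- The identity of `M`, as an additive map from the twisted module to `M`. -/
noncomputable def untwist (x : Γ.roots → ℂ) (M : Γ.BijMod) :
    ((Γ.twistModule x).obj M) →+ M.obj.obj := AddMonoidHom.id M.obj.obj

theorem untwist_smul (x : Γ.roots → ℂ) (M : Γ.BijMod) (a : UniversalEnvelopingAlgebra ℂ g)
    (v : (Γ.twistModule x).obj M) :
    Γ.untwist x M (a • v) = locAction M (Γ.theta x (Γ.toLoc a)) (Γ.untwist x M v) := rfl

section
attribute [local instance 100] LieRing.ofAssociativeRing

theorem theta_envelopingIncl (x : Γ.roots → ℂ) (a : UniversalEnvelopingAlgebra ℂ H) :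
    Γ.theta x (Γ.toLoc (envelopingIncl H a)) =
      Γ.toLoc (envelopingIncl H (shiftHom (Γ.weightOf x) (Γ.weightOf_lie x) a)) := by
  have key : ((Γ.theta x).toAlgHom.comp (Γ.toLoc.comp (envelopingIncl H))) =
      (Γ.toLoc.comp ((envelopingIncl H).comp
        (shiftHom (Γ.weightOf x) (Γ.weightOf_lie x)))) := by
    apply UniversalEnvelopingAlgebra.hom_ext
    refine LieHom.ext fun h => ?_
    change Γ.theta x (Γ.toLoc (envelopingIncl H (UniversalEnvelopingAlgebra.ι ℂ h))) =
      Γ.toLoc (envelopingIncl H (shiftHom (Γ.weightOf x) (Γ.weightOf_lie x) (UniversalEnvelopingAlgebra.ι ℂ h)))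
    rw [shiftHom_ι, map_add, map_add, envelopingIncl_ι, theta_ι, AlgHom.commutes, AlgHom.commutes]
  exact DFunLike.congr_fun key a

end

theorem isGHModule_twistModule (x : Γ.roots → ℂ) (M : Γ.BijMod) :
    isGHModule H ((Γ.twistModule x).obj M) := by
  obtain ⟨h1, h2⟩ := M.obj.property
  have hact : ∀ (a : UniversalEnvelopingAlgebra ℂ H) (v : (ModuleCat.restrictScalars
      (envelopingIncl H).toRingHom).obj ((Γ.twistModule x).obj M)),
      Γ.untwist x M (a • v) = envelopingIncl H (shiftHom (Γ.weightOf x) (Γ.weightOf_lie x) a) •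
        Γ.untwist x M v := by
    intro a v
    refine (Γ.untwist_smul x M (envelopingIncl H a) v).trans ?_
    rw [theta_envelopingIncl, locAction_toLoc]
  have hneg : ∀ a b : H, (-Γ.weightOf x) ⁅a, b⁆ = 0 := fun a b => by
    simp [Γ.weightOf_lie x a b]
  constructor
  · have : RingHomSurjective (shiftHom (Γ.weightOf x) (Γ.weightOf_lie x)).toRingHom :=
      ⟨fun y => ⟨_, shiftHom_neg _ (Γ.weightOf_lie x) hneg y⟩⟩
    let l : ((ModuleCat.restrictScalars (envelopingIncl H).toRingHom).obj
        ((Γ.twistModule x).obj M)) →ₛₗ[(shiftHom (Γ.weightOf x) (Γ.weightOf_lie x)).toRingHom]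
        ((ModuleCat.restrictScalars (envelopingIncl H).toRingHom).obj M.obj.obj) :=
      { toFun := Γ.untwist x M
        map_add' := map_add (Γ.untwist x M)
        map_smul' := hact }
    exact (l.isSemisimpleModule_iff_of_bijective Function.bijective_id).2 h1
  · intro v
    refine finite_span_of_surjective (N := ((ModuleCat.restrictScalars
        (envelopingIncl H).toRingHom).obj M.obj.obj)) (shiftHom (-Γ.weightOf x) hneg)
      (fun y => ⟨_, shiftHom_neg' _ (Γ.weightOf_lie x) hneg y⟩)
      (N' := (ModuleCat.restrictScalars (envelopingIncl H).toRingHom).obj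
        ((Γ.twistModule x).obj M))
      (AddMonoidHom.id M.obj.obj) (fun a w => ?_) (Γ.untwist x M v) (h2 _)
    have h3 := hact (shiftHom (-Γ.weightOf x) hneg a) w
    rw [shiftHom_neg] at h3
    exact h3.symm

theorem isBijective_twistModule (x : Γ.roots → ℂ) (M : Γ.BijMod) :
    Γ.isBijective ⟨(Γ.twistModule x).obj M, Γ.isGHModule_twistModule x M⟩ := by
  intro γ
  have h := M.property γ
  have key : ∀ v : M.obj.obj, locAction M (Γ.theta x (Γ.toLoc (Γ.rootVec γ))) v =
      Γ.rootVec γ • v := fun v => by rw [theta_rootVec, locAction_toLoc]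
  rw [← funext key] at h
  exact h

/-- The twisting functor `Φ_Γ^ν` on `C_Γ`, where `ν = ∑ γ, x γ • γ`. -/
noncomputable def twist (x : Γ.roots → ℂ) : Γ.BijMod ⥤ Γ.BijMod :=
  Γ.isBijective.lift ((isGHModule H).lift (Γ.twistModule x) (Γ.isGHModule_twistModule x))
    (Γ.isBijective_twistModule x)

end CommutingSet

end Twisting

end WeightMod

/-!
# Twisting preserves extensions of `Γ`-bijective modules

The idea is to extend the twist to an exact endofunctor of the whole category of `(g, H)`-modules.
Localization `M ↦ S⁻¹M` at the multiplicative set `S` generated by the root vectors `f γ` is exact,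
and `S⁻¹M` is again a `(g, H)`-module: the fractions with a fixed denominator form a copy of a
quotient of `M` on which `U(H)` acts through an automorphism of `U(H)`
(`exists_algEquiv_fraction`), so that `S⁻¹M` is a sum of semisimple, locally finite `H`-modules.
Twisting the action of `U_Γ` on `S⁻¹M` by `Θ_x` gives an exact `ℂ`-linear endofunctor `locTwist x`,
which agrees with `twist x` on `Γ`-bijective modules, as these are their own localizations
(`twistIso`).

As `Θ_x ∘ Θ_{-x} = 1`, the composite of `locTwist x` and `locTwist (-x)` is the localization, and
the map from a module to its localization is a natural transformation `locTwistUnit` from the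
identity to this composite, invertible at `Γ`-bijective modules. A natural transformation between
exact functors is compatible with the induced maps on `Ext` (`comp_mk₀_app_eq`), because
extension classes are composites of morphisms and classes of short exact sequences
(`exists_extClass_comp_eq`). Hence going from `x` to `-x` and going from `-x` to `x` are both
bijective on the relevant `Ext` groups, and so is `locTwist x` by itself
(`bijective_mapExactFunctor`).
-/

open CategoryTheory
open scoped ModuleCat

/-! ### Extension classes as composites of classes of short exact sequences -/

namespace DerivedCategory

open CategoryTheory HomologicalComplex

universe w v u₁

variable {C : Type u₁} [Category.{v} C] [Abelian C] [HasDerivedCategory.{w} C]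

/-- A morphism from an object `X` placed in degree `i` to a complex in degrees `≤ n < i` is
killed by an epimorphism onto `X`: represent it by a roof `X ⟵ K ⟶ L` with `K` in degrees `≤ i`,
and take the degree `i` component of `K ⟶ X`. -/
theorem exists_epi_single_map_comp_eq_zero {X : C} {L : CochainComplex C ℤ} {i : ℤ}
    (φ : Q.obj ((single C (ComplexShape.up ℤ) i).obj X) ⟶ Q.obj L)
    (n : ℤ) (hn : n < i) [L.IsStrictlyLE n] :
    ∃ (X' : C) (p : X' ⟶ X), Epi p ∧ Q.map ((single C (ComplexShape.up ℤ) i).map p) ≫ φ = 0 := by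
  have : CochainComplex.IsStrictlyLE ((single C (ComplexShape.up ℤ) i).obj X) i :=
    inferInstanceAs (((CochainComplex.singleFunctor C i).obj X).IsStrictlyLE i)
  obtain ⟨K, _, π, h, t, rfl⟩ := right_fac_of_isStrictlyLE φ i
  have h' := h
  rw [isIso_Q_map_iff_quasiIso] at h'
  have hd : K.d i (i + 1) = 0 := (K.isZero_of_isStrictlyLE i (i + 1) (by simp)).eq_of_tgt _ _
  let e := K.iCyclesIso i (i + 1) (by simp) hd
  let p := e.inv ≫ K.homologyπ i ≫ homologyMap π i ≫ (singleObjHomologySelfIso _ _ _).hom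
  have hp : π.f i = p ≫ (singleObjXSelf (ComplexShape.up ℤ) i X).inv := by
    rw [← cancel_epi e.hom]
    dsimp only [p, e]
    rw [Category.assoc, Category.assoc, Category.assoc, Iso.hom_inv_id_assoc,
      homologyπ_naturality_assoc, homologyπ_singleObjHomologySelfIso_hom_assoc,
      ← singleObjCyclesSelfIso_inv_iCycles, Iso.hom_inv_id_assoc, iCyclesIso_hom, ← cyclesMap_i]
  let incl : (single C (ComplexShape.up ℤ) i).obj (K.X i) ⟶ K :=
    mkHomFromSingle (𝟙 (K.X i)) (by
      rintro _ rfl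
      rw [hd, Limits.comp_zero])
  have hincl : incl ≫ π = (single C (ComplexShape.up ℤ) i).map p := by
    apply HomologicalComplex.from_single_hom_ext
    rw [comp_f, mkHomFromSingle_f, hp, single_map_f_self, Category.comp_id]
  have hzero : incl ≫ t = 0 := by
    apply HomologicalComplex.from_single_hom_ext
    apply (L.isZero_of_isStrictlyLE n i hn).eq_of_tgt
  refine ⟨K.X i, p, ?_, ?_⟩
  · have : IsIso (homologyMap π i) := inferInstance
    exact epi_comp _ _
  · rw [← hincl, Q.map_comp, Category.assoc, IsIso.hom_inv_id_assoc, ← Q.map_comp, hzero,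
      Q.map_zero]

end DerivedCategory

namespace CategoryTheory.Abelian.Ext

open _root_.DerivedCategory Limits

universe w w' v v' u₁ u₂

variable {C : Type u₁} [Category.{v} C] [Abelian C] [HasExt.{w} C]

/-- Every extension class of positive degree is effaceable: it is killed by pulling back along
some epimorphism. -/
theorem exists_epi_mk₀_comp_eq_zero {X Y : C} {n : ℕ} (α : Ext X Y (n + 1)) :
    ∃ (X' : C) (p : X' ⟶ X), Epi p ∧ (mk₀ p).comp α (zero_add (n + 1)) = 0 := by
  let := HasDerivedCategory.standard C
  -- `κ` identifies `Y[n + 1]` with the complex that has `Y` in degree `-(n + 1) < 0`.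
  let κ := ((singleFunctors C).shiftIso (n + 1) (-(n + 1)) 0 (by lia)).hom.app Y
  obtain ⟨X', p, hp, h⟩ := exists_epi_single_map_comp_eq_zero
    (L := (CochainComplex.singleFunctor C (-(n + 1))).obj Y) (α.hom ≫ κ) (-(n + 1)) (by lia)
  refine ⟨X', p, hp, ?_⟩
  apply homEquiv.injective
  rw [← cancel_mono κ]
  have h' : (((singleFunctor C 0).map p) ≫ α.hom) ≫ κ = 0 := by
    rw [Category.assoc]; exact h
  rw [singleFunctor_map_comp_hom] at h'
  refine h'.trans ?_
  exact ((congrArg (· ≫ κ) (zero_hom X' Y (n + 1))).trans Limits.zero_comp).symm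

/-- Every extension class of degree `n + 1` is the composite of the class of a short exact sequence
and an extension class of degree `n`. -/
theorem exists_extClass_comp_eq {X Y : C} {n : ℕ} (α : Ext X Y (n + 1)) :
    ∃ (K E : C) (i : K ⟶ E) (p : E ⟶ X) (w : i ≫ p = 0)
      (hS : (ShortComplex.mk i p w).ShortExact) (β : Ext K Y n),
      α = hS.extClass.comp β (add_comm 1 n) := by
  obtain ⟨E, p, hp, h⟩ := exists_epi_mk₀_comp_eq_zero α
  have hS : (ShortComplex.mk (kernel.ι p) p (kernel.condition p)).ShortExact :=
    { exact := ShortComplex.exact_kernel p }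
  obtain ⟨β, hβ⟩ := contravariant_sequence_exact₃ hS Y α h (add_comm 1 n)
  exact ⟨_, _, _, _, _, hS, β, hβ.symm⟩

variable {D : Type u₂} [Category.{v'} D] [Abelian D] [HasExt.{w'} D]
  (F : C ⥤ D) [F.Additive] [PreservesFiniteLimits F] [PreservesFiniteColimits F]
  (G : D ⥤ C) [G.Additive] [PreservesFiniteLimits G] [PreservesFiniteColimits G]

theorem mapExactFunctor_extClass_comp {S : ShortComplex C} (hS : S.ShortExact) {Y : C} {n m : ℕ}
    (β : Ext S.X₁ Y n) (h : 1 + n = m) :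
    (hS.extClass.comp β h).mapExactFunctor F =
      (hS.map_of_exact F).extClass.comp (β.mapExactFunctor F) h := by
  rw [mapExactFunctor_comp, mapExactFunctor_extClass]
  rfl

/-- A natural transformation from the identity to a composite of exact functors is compatible
with the maps that these functors induce on extension classes. -/
theorem comp_mk₀_app_eq (τ : 𝟭 C ⟶ F ⋙ G) {X Y : C} {n : ℕ} (α : Ext X Y n) :
    α.comp (mk₀ (τ.app Y)) (add_zero n) =
      (mk₀ (τ.app X)).comp ((α.mapExactFunctor F).mapExactFunctor G) (zero_add n) := by
  induction n generalizing X with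
  | zero =>
    obtain ⟨f, rfl⟩ := (mk₀_bijective X Y).2 α
    rw [mapExactFunctor_mk₀, mapExactFunctor_mk₀, mk₀_comp_mk₀]
    refine Eq.trans ?_ (mk₀_comp_mk₀ _ _).symm
    exact congrArg mk₀ (τ.naturality f)
  | succ n ih =>
    obtain ⟨K, E, i, p, w, hS, β, rfl⟩ := exists_extClass_comp_eq α
    have hFG := (congrArg (fun γ => γ.mapExactFunctor G)
      (mapExactFunctor_extClass_comp F hS β (add_comm 1 n))).trans
      (mapExactFunctor_extClass_comp G (hS.map_of_exact F) (β.mapExactFunctor F) (add_comm 1 n))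
    refine Eq.trans ?_ (congrArg (fun γ => (mk₀ (τ.app X)).comp γ (zero_add (n + 1))) hFG.symm)
    rw [comp_assoc_of_third_deg_zero, ih]
    -- `τ` is a morphism from the short exact sequence to its image under the two functors.
    let f : ShortComplex.mk i p w ⟶ ((ShortComplex.mk i p w).map F).map G :=
      { τ₁ := τ.app K
        τ₂ := τ.app E
        τ₃ := τ.app X
        comm₁₂ := (τ.naturality i).symm
        comm₂₃ := (τ.naturality p).symm }
    have hnat := hS.extClass_naturality ((hS.map_of_exact F).map_of_exact G) f
    refine (comp_assoc_of_second_deg_zero _ _ _ _).symm.trans ?_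
    refine (congrArg (fun γ => γ.comp ((β.mapExactFunctor F).mapExactFunctor G)
      (add_comm 1 n)) hnat).trans ?_
    exact comp_assoc _ _ _ (zero_add 1) (add_comm 1 n) (by omega)

/-- If the identity maps to a composite `F ⋙ G` of exact functors by a natural transformation that
is invertible at `X` and `Y`, then `F` followed by `G` is bijective on `Ext X Y n`. -/
theorem bijective_mapExactFunctor_comp (τ : 𝟭 C ⟶ F ⋙ G) (X Y : C) [IsIso (τ.app X)]
    [IsIso (τ.app Y)] (n : ℕ) :
    Function.Bijective fun α : Ext X Y n => (α.mapExactFunctor F).mapExactFunctor G := by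
  have hX : ∀ β : Ext (G.obj (F.obj X)) (G.obj (F.obj Y)) n,
      (mk₀ (inv (τ.app X))).comp ((mk₀ (τ.app X)).comp β (zero_add n)) (zero_add n) = β := by
    intro β
    refine (mk₀_comp_mk₀_assoc _ _ _).trans ?_
    rw [IsIso.inv_hom_id]
    exact mk₀_id_comp β
  have hY : ∀ α : Ext X Y n,
      (α.comp (mk₀ (τ.app Y)) (add_zero n)).comp (mk₀ (inv (τ.app Y))) (add_zero n) = α := by
    intro α
    rw [comp_assoc_of_third_deg_zero, mk₀_comp_mk₀, IsIso.hom_inv_id]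
    exact comp_mk₀_id α
  constructor
  · intro α β h
    have h' := congrArg (fun γ => (mk₀ (τ.app X)).comp γ (zero_add n)) h
    simp only [← comp_mk₀_app_eq] at h'
    rw [← hY α, ← hY β, h']
  · intro β
    let α : Ext X Y n := ((mk₀ (τ.app X)).comp β (zero_add n)).comp (mk₀ (inv (τ.app Y)))
      (add_zero n)
    refine ⟨α, ?_⟩
    have h' : α.comp (mk₀ (τ.app Y)) (add_zero n) = (mk₀ (τ.app X)).comp β (zero_add n) := by
      dsimp only [α]
      rw [comp_assoc_of_third_deg_zero, mk₀_comp_mk₀, IsIso.inv_hom_id]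
      exact comp_mk₀_id _
    rw [comp_mk₀_app_eq F G τ] at h'
    have h'' := congrArg (fun γ => (mk₀ (inv (τ.app X))).comp γ (zero_add n)) h'
    exact (hX _).symm.trans (h''.trans (hX _))

/-- Two-out-of-six: if the identities of `C` and `D` map to `F ⋙ G` and `G ⋙ F` by natural
transformations that are invertible at the objects concerned, then `F` is bijective on `Ext`. -/
theorem bijective_mapExactFunctor (τ : 𝟭 C ⟶ F ⋙ G) (σ : 𝟭 D ⟶ G ⋙ F) (X Y : C)
    [IsIso (τ.app X)] [IsIso (τ.app Y)] [IsIso (σ.app (F.obj X))] [IsIso (σ.app (F.obj Y))]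
    (n : ℕ) : Function.Bijective fun α : Ext X Y n => α.mapExactFunctor F := by
  have h₁ := bijective_mapExactFunctor_comp F G τ X Y n
  have h₂ := bijective_mapExactFunctor_comp G F σ (F.obj X) (F.obj Y) n
  refine ⟨fun α β h => h₁.1 (congrArg (fun γ => γ.mapExactFunctor G) h), fun β => ?_⟩
  obtain ⟨α, hα⟩ := h₁.2 (β.mapExactFunctor G)
  exact ⟨α, h₂.1 (congrArg (fun γ => γ.mapExactFunctor F) hα)⟩

/-- `Ext` depends on its arguments only up to isomorphism. -/
noncomputable def linearEquivOfIso (R : Type*) [CommRing R] [Linear R C] {X X' Y Y' : C}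
    (e : X ≅ X') (e' : Y ≅ Y') (n : ℕ) : Ext X Y n ≃ₗ[R] Ext X' Y' n where
  toFun α := (mk₀ e.inv).comp (α.comp (mk₀ e'.hom) (add_zero n)) (zero_add n)
  invFun β := (mk₀ e.hom).comp (β.comp (mk₀ e'.inv) (add_zero n)) (zero_add n)
  map_add' := by simp
  map_smul' := by simp
  left_inv α := by
    simp only [comp_assoc_of_third_deg_zero, mk₀_comp_mk₀,
      mk₀_comp_mk₀_assoc, Iso.hom_inv_id, mk₀_id_comp, comp_mk₀_id]
  right_inv α := by
    simp only [comp_assoc_of_third_deg_zero, mk₀_comp_mk₀,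
      mk₀_comp_mk₀_assoc, Iso.inv_hom_id, mk₀_id_comp, comp_mk₀_id]

end CategoryTheory.Abelian.Ext

/-! ### Ore localization of modules -/

namespace OreLocalization

universe v

variable {R : Type v} [Ring R] {S : Submonoid R} [OreSet S]

section Map

variable {X Y Z : Type*} [AddCommGroup X] [Module R X] [AddCommGroup Y] [Module R Y]
  [AddCommGroup Z] [Module R Z]

variable (S) in
/-- The canonical map of a module to its localization, as an additive map. -/
def numeratorAddHom (X : Type*) [AddCommGroup X] [Module R X] : X →+ OreLocalization S X where
  toFun v := v /ₒ 1
  map_zero' := zero_oreDiv 1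
  map_add' _ _ := add_oreDiv.symm

theorem numeratorAddHom_smul (r : R) (v : X) :
    numeratorAddHom S X (r • v) =
      (r /ₒ (1 : S) : OreLocalization S R) • numeratorAddHom S X v :=
  smul_div_one.symm

theorem oreDiv_eq_zero_iff {v : X} {s : S} :
    (v /ₒ s : OreLocalization S X) = 0 ↔ ∃ t : S, (t : R) • v = 0 := by
  rw [← zero_oreDiv s, oreDiv_eq_iff]
  constructor
  · rintro ⟨t, r, h, h'⟩
    obtain ⟨t', ht'⟩ := ore_right_cancel (t : R) r s h'
    refine ⟨t' * t, ?_⟩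
    rw [Submonoid.coe_mul, ht', mul_smul, ← h, smul_zero, smul_zero]
  · rintro ⟨t, h⟩
    exact ⟨t, t, by rw [smul_zero, h], rfl⟩

variable (S) in
/-- The map `v / s ↦ f v / s` induced on localizations by a linear map. -/
def mapAddHom (f : X →ₗ[R] Y) : OreLocalization S X →+ OreLocalization S Y where
  toFun := liftExpand (fun v s => f v /ₒ s) fun v t s h => by
    rw [map_smul]; exact OreLocalization.expand _ _ _ _
  map_zero' := by
    rw [← zero_oreDiv (1 : S), liftExpand_of, map_zero, zero_oreDiv]
  map_add' x y := by
    induction x with | _ v s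
    induction y with | _ w t
    obtain ⟨r, s', h, h'⟩ := oreDivAddChar' v w s t
    rw [h', liftExpand_of, liftExpand_of, liftExpand_of, oreDiv_add_char s t r s' h, map_add,
      Submonoid.smul_def, map_smul, map_smul, Submonoid.smul_def]

theorem mapAddHom_oreDiv (f : X →ₗ[R] Y) (v : X) (s : S) :
    mapAddHom S f (v /ₒ s) = f v /ₒ s := rfl

variable (S) in
/-- Localization of linear maps, as linear maps over the localized ring. -/
def mapLin (f : X →ₗ[R] Y) : OreLocalization S X →ₗ[OreLocalization S R] OreLocalization S Y where
  __ := mapAddHom S f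
  map_smul' r x := by
    induction x with | _ v s
    induction r with | _ a t
    obtain ⟨a', s', h, h'⟩ := oreDivSMulChar' a v t s
    change mapAddHom S f ((a /ₒ t) • (v /ₒ s)) = (a /ₒ t) • mapAddHom S f (v /ₒ s)
    rw [h', mapAddHom_oreDiv, mapAddHom_oreDiv, map_smul, oreDiv_smul_char _ _ _ _ _ _ h]

theorem mapLin_oreDiv (f : X →ₗ[R] Y) (v : X) (s : S) : mapLin S f (v /ₒ s) = f v /ₒ s := rfl

theorem mapLin_exact {f : X →ₗ[R] Y} {k : Y →ₗ[R] Z} (h : Function.Exact f k) :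
    Function.Exact (mapLin S f) (mapLin S k) := by
  intro y
  induction y with | _ v s
  rw [mapLin_oreDiv, oreDiv_eq_zero_iff]
  constructor
  · rintro ⟨t, ht⟩
    rw [← map_smul] at ht
    obtain ⟨w, hw⟩ := (h _).1 ht
    refine ⟨w /ₒ (t * s), ?_⟩
    rw [mapLin_oreDiv, hw, OreLocalization.expand' v s t, Submonoid.smul_def]
  · rintro ⟨x, hx⟩
    induction x with | _ w t
    rw [mapLin_oreDiv, ← sub_eq_zero] at hx
    have h1 : mapLin S k (mapLin S f (w /ₒ t)) = 0 := by
      rw [mapLin_oreDiv, mapLin_oreDiv, h.apply_apply_eq_zero, zero_oreDiv]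
    rw [sub_eq_zero] at hx
    rw [mapLin_oreDiv, hx, mapLin_oreDiv] at h1
    exact oreDiv_eq_zero_iff.1 h1

end Map

section Extension

variable {A B : Type*} [AddCommGroup A] [Module (OreLocalization S R) A] [AddCommGroup B]
  [Module (OreLocalization S R) B]

/-- An additive map between modules over the localized ring is linear as soon as it commutes
with the action of the numerators. -/
theorem map_smul_of_numerator (φ : A →+ B)
    (h : ∀ (r : R) (a : A), φ ((r /ₒ (1 : S) : OreLocalization S R) • a) =
      (r /ₒ (1 : S) : OreLocalization S R) • φ a) (u : OreLocalization S R) (a : A) :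
    φ (u • a) = u • φ a := by
  induction u with | _ r s
  have hs : ((1 : R) /ₒ s : OreLocalization S R) * ((s : R) /ₒ (1 : S)) = 1 := by
    rw [OreLocalization.one_div_mul, one_mul, OreLocalization.div_eq_one]
  have hr : ((s : R) /ₒ (1 : S) : OreLocalization S R) * (r /ₒ s) = r /ₒ (1 : S) :=
    OreLocalization.mul_cancel
  rw [← one_smul (OreLocalization S R) (φ _), ← hs, mul_smul, ← h, ← mul_smul, hr, h, ← hr,
    mul_smul, ← mul_smul, hs, one_smul]

end Extension

section Bijective

variable {X : Type*} [AddCommGroup X] [Module R X]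

/-- A module on which the multiplicative set acts bijectively is its own localization. -/
theorem bijective_numeratorAddHom (h : ∀ s : S, Function.Bijective fun v : X => (s : R) • v) :
    Function.Bijective (numeratorAddHom S X) := by
  constructor
  · rw [injective_iff_map_eq_zero]
    intro v hv
    obtain ⟨t, ht⟩ := oreDiv_eq_zero_iff.1 hv
    exact (h t).1 (by simpa using ht)
  · intro x
    induction x with | _ v s
    obtain ⟨w, rfl⟩ := (h s).2 v
    refine ⟨w, ?_⟩
    change w /ₒ (1 : S) = ((s : R) • w) /ₒ s
    rw [OreLocalization.expand' w 1 s, mul_one, Submonoid.smul_def]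

end Bijective

/-- The localization functor on modules. -/
def moduleFunctor (S : Submonoid R) [OreSet S] :
    ModuleCat.{v} R ⥤ ModuleCat.{v} (OreLocalization S R) where
  obj X := ModuleCat.of _ (OreLocalization S X)
  map f := ModuleCat.ofHom (mapLin S f.hom)
  map_id _ := ModuleCat.hom_ext (LinearMap.ext (OreLocalization.ind fun _ _ => rfl))
  map_comp _ _ := ModuleCat.hom_ext (LinearMap.ext (OreLocalization.ind fun _ _ => rfl))

instance : (moduleFunctor S).Additive where
  map_add := ModuleCat.hom_ext (LinearMap.ext (OreLocalization.ind fun _ _ => add_oreDiv.symm))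

end OreLocalization

namespace WeightMod

/-! ### Localizing and twisting `(g, H)`-modules -/

theorem isSemisimpleModule_range {A B N N' : Type*} [Ring A] [Ring B] {σ : A →+* B}
    [RingHomSurjective σ] [AddCommGroup N] [Module A N] [AddCommGroup N'] [Module B N']
    [IsSemisimpleModule A N] (l : N →ₛₗ[σ] N') :
    IsSemisimpleModule B (LinearMap.range l) := by
  let l' : (N ⧸ LinearMap.ker l) →ₛₗ[σ] LinearMap.range l :=
    (LinearMap.ker l).liftQ l.rangeRestrict (by simp)
  refine (l'.isSemisimpleModule_iff_of_bijective ⟨?_, ?_⟩).1 inferInstance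
  · rw [← LinearMap.ker_eq_bot]
    exact Submodule.ker_liftQ_eq_bot _ _ _ (by simp)
  · rw [← LinearMap.range_eq_top, Submodule.range_liftQ]
    exact l.range_rangeRestrict

/-- The automorphism `h ↦ h + μ(h)` of `U(A)`, for a linear form `μ` vanishing on brackets. -/
noncomputable def shiftEquiv {A : Type u} [LieRing A] [LieAlgebra ℂ A] (μ : Module.Dual ℂ A)
    (hμ : ∀ a b : A, μ ⁅a, b⁆ = 0) :
    UniversalEnvelopingAlgebra ℂ A ≃ₐ[ℂ] UniversalEnvelopingAlgebra ℂ A :=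
  have hμ' : ∀ a b : A, (-μ) ⁅a, b⁆ = 0 := fun a b => by simp [hμ a b]
  AlgEquiv.ofAlgHom (shiftHom μ hμ) (shiftHom (-μ) hμ')
    (AlgHom.ext (shiftHom_neg μ hμ hμ')) (AlgHom.ext (shiftHom_neg' μ hμ hμ'))

namespace CommutingSet

variable {g : Type u} [LieRing g] [LieAlgebra ℂ g] {H : LieSubalgebra ℂ g} (Γ : CommutingSet H)

variable [FiniteDimensional ℂ g] [LieAlgebra.HasCentralRadical ℂ g] [H.IsCartanSubalgebra]

/-- Both sides are polynomial in `x`, and for `x ∈ ℕ^Γ` the two automorphisms are inverse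
conjugations. -/
theorem theta_theta_neg (x : Γ.roots → ℂ) (r : Γ.Loc) : Γ.theta x (Γ.theta (-x) r) = r := by
  have hΘ := Γ.isTwistFamily_theta
  have h1 := comp_mem_polyMap (fun i => -MvPolynomial.X i) (hΘ.poly r)
  simp only [map_neg, MvPolynomial.eval_X] at h1
  refine polyMap_ext (apply_mem_polyMap (T := fun x => (Γ.theta x).toLinearMap)
    (fun v => hΘ.poly v) h1) (const_mem_polyMap r) (fun n => ?_) x
  have h2 := hΘ.conj (fun i => -(n i : ℤ)) r
  have h3 := hΘ.conj (fun i => (n i : ℤ))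
  push_cast at h2 h3
  have h4 := unitMonomial_neg Γ.rootUnit Γ.rootUnit_commute (fun i => (n i : ℤ))
  have h5 : (-fun i => (n i : ℤ)) = fun i => -(n i : ℤ) := rfl
  rw [h5] at h4
  simp only [AlgEquiv.toLinearMap_apply, h2, h3, h4]
  simp [mul_assoc]

section
attribute [local instance 100] LieRing.ofAssociativeRing

/-- Moving an element of the multiplicative set across `U(H)` changes `U(H)` by an automorphism:
each `f γ` has weight `-γ`, so that `h` becomes `h + γ(h)`. -/
theorem exists_algEquiv_mul (s : Γ.multSet) :
    ∃ σ : UniversalEnvelopingAlgebra ℂ H ≃ₐ[ℂ] UniversalEnvelopingAlgebra ℂ H,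
      ∀ y, (s : UniversalEnvelopingAlgebra ℂ g) * envelopingIncl H y =
        envelopingIncl H (σ y) * s := by
  obtain ⟨s, hs⟩ := s
  induction hs using Submonoid.closure_induction with
  | mem s hs =>
    obtain ⟨γ, rfl⟩ := hs
    classical
    have hγ : ∀ a b : H, (γ : Module.Dual ℂ H) ⁅a, b⁆ = 0 := fun a b => by
      simpa [weightOf, Pi.single_apply] using Γ.weightOf_lie (Pi.single γ 1) a b
    refine ⟨shiftEquiv γ hγ, fun y => ?_⟩
    let A : Subalgebra ℂ (UniversalEnvelopingAlgebra ℂ H) :=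
      { carrier := {y | Γ.rootVec γ * envelopingIncl H y =
          envelopingIncl H (shiftHom γ hγ y) * Γ.rootVec γ}
        mul_mem' := fun {a b} ha hb => by
          simp only [Set.mem_ofPred_eq, map_mul] at ha hb ⊢
          rw [← mul_assoc, ha, mul_assoc, hb, mul_assoc]
        add_mem' := fun {a b} ha hb => by
          simp only [Set.mem_ofPred_eq, map_add] at ha hb ⊢
          rw [mul_add, ha, hb, add_mul]
        algebraMap_mem' := fun c => by
          simp only [Set.mem_ofPred_eq, AlgHom.commutes]
          exact (Algebra.commutes _ _).symm }
    have hA : A = ⊤ := enveloping_eq_top A fun h => by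
      change Γ.rootVec γ * envelopingIncl H (UniversalEnvelopingAlgebra.ι ℂ h) =
        envelopingIncl H (shiftHom γ hγ (UniversalEnvelopingAlgebra.ι ℂ h)) * Γ.rootVec γ
      rw [shiftHom_ι, map_add, envelopingIncl_ι, AlgHom.commutes, add_mul, Γ.ι_mul_rootVec,
        ← Algebra.smul_def, sub_add_cancel]
    have hy : y ∈ A := hA ▸ Algebra.mem_top
    exact hy
  | one => exact ⟨AlgEquiv.refl, fun y => by simp⟩
  | mul a b _ _ ha hb =>
    obtain ⟨σ, hσ⟩ := ha
    obtain ⟨τ, hτ⟩ := hb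
    refine ⟨τ.trans σ, fun y => ?_⟩
    simp only at hσ hτ ⊢
    rw [mul_assoc, hτ, ← mul_assoc, hσ, mul_assoc]
    rfl

end

/-- The `g`-module obtained by localizing a `g`-module and twisting the action of `U_Γ` on the
localization by `Θ_x`. -/
noncomputable def locTwistModule (x : Γ.roots → ℂ) :
    ModuleCat.{u} (UniversalEnvelopingAlgebra ℂ g) ⥤
      ModuleCat.{u} (UniversalEnvelopingAlgebra ℂ g) :=
  OreLocalization.moduleFunctor Γ.multSet ⋙
    ModuleCat.restrictScalars (Γ.theta x).toRingEquiv.toRingHom ⋙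
      ModuleCat.restrictScalars Γ.toLoc.toRingHom

instance (x : Γ.roots → ℂ) : (Γ.locTwistModule x).Additive := by
  unfold locTwistModule; infer_instance

theorem locTwistModule_map_exact (x : Γ.roots → ℂ)
    (T : ShortComplex (ModuleCat.{u} (UniversalEnvelopingAlgebra ℂ g))) (h : T.Exact) :
    (T.map (Γ.locTwistModule x)).Exact := by
  rw [ShortComplex.ShortExact.moduleCat_exact_iff_function_exact] at h ⊢
  exact OreLocalization.mapLin_exact h

instance (x : Γ.roots → ℂ) : Limits.PreservesFiniteLimits (Γ.locTwistModule x) := by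
  have := ((Functor.exact_tfae (Γ.locTwistModule x)).out 1 3).mp (Γ.locTwistModule_map_exact x)
  exact this.1

instance (x : Γ.roots → ℂ) : Limits.PreservesFiniteColimits (Γ.locTwistModule x) := by
  have := ((Functor.exact_tfae (Γ.locTwistModule x)).out 1 3).mp (Γ.locTwistModule_map_exact x)
  exact this.2

/-- The fraction `v / s`, as an element of the localized and twisted module. -/
noncomputable def fraction (x : Γ.roots → ℂ) (X : ModuleCat.{u} (UniversalEnvelopingAlgebra ℂ g))
    (s : Γ.multSet) : X →+ (Γ.locTwistModule x).obj X where
  toFun v := OreLocalization.oreDiv v s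
  map_zero' := OreLocalization.zero_oreDiv s
  map_add' _ _ := OreLocalization.add_oreDiv.symm

variable {Γ} in
theorem exists_fraction_eq {x : Γ.roots → ℂ} {X : ModuleCat.{u} (UniversalEnvelopingAlgebra ℂ g)}
    (z : (Γ.locTwistModule x).obj X) : ∃ s v, Γ.fraction x X s v = z := by
  refine OreLocalization.ind (β := fun z => ∃ s v, Γ.fraction x X s v = z) (fun v s => ?_) z
  exact ⟨s, v, rfl⟩

/-- On fractions with a fixed denominator, `U(H)` acts through an automorphism of `U(H)`. -/
theorem exists_algEquiv_fraction (x : Γ.roots → ℂ) (s : Γ.multSet) :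
    ∃ σ : UniversalEnvelopingAlgebra ℂ H ≃ₐ[ℂ] UniversalEnvelopingAlgebra ℂ H,
      ∀ (X : ModuleCat.{u} (UniversalEnvelopingAlgebra ℂ g)) (y) (v : X),
        Γ.fraction x X s (envelopingIncl H y • v) =
          envelopingIncl H (σ y) • Γ.fraction x X s v := by
  obtain ⟨σ, hσ⟩ := Γ.exists_algEquiv_mul s
  refine ⟨((shiftEquiv (Γ.weightOf x) (Γ.weightOf_lie x)).trans σ).symm, fun X y v => ?_⟩
  obtain ⟨y, rfl⟩ := ((shiftEquiv (Γ.weightOf x) (Γ.weightOf_lie x)).trans σ).surjective y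
  rw [AlgEquiv.symm_apply_apply]
  change _ = (Γ.theta x (Γ.toLoc (envelopingIncl H y)) • OreLocalization.oreDiv v s :
    OreLocalization Γ.multSet X)
  rw [theta_envelopingIncl]
  refine Eq.trans ?_ (OreLocalization.oreDiv_smul_char _ v 1 s _ s (hσ _)).symm
  rw [mul_one]
  rfl

theorem fraction_smul (x : Γ.roots → ℂ) (X : ModuleCat.{u} (UniversalEnvelopingAlgebra ℂ g))
    (s : Γ.multSet) (c : ℂ) (v : X) : Γ.fraction x X s (c • v) = c • Γ.fraction x X s v := by
  obtain ⟨σ, hσ⟩ := Γ.exists_algEquiv_fraction x s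
  have h := hσ X (algebraMap ℂ _ c) v
  rwa [AlgEquiv.commutes, AlgHom.commutes, algebraMap_smul, algebraMap_smul] at h

theorem isGHModule_locTwistModule (x : Γ.roots → ℂ)
    {X : ModuleCat.{u} (UniversalEnvelopingAlgebra ℂ g)} (hX : isGHModule H X) :
    isGHModule H ((Γ.locTwistModule x).obj X) := by
  obtain ⟨h1, h2⟩ := hX
  constructor
  · choose σ hσ using Γ.exists_algEquiv_fraction x
    have hsurj : ∀ s, RingHomSurjective (σ s).toAlgHom.toRingHom := fun s => ⟨(σ s).surjective⟩
    let l : ∀ s : Γ.multSet, ((ModuleCat.restrictScalars (envelopingIncl H).toRingHom).obj X)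
        →ₛₗ[(σ s).toAlgHom.toRingHom]
        ((ModuleCat.restrictScalars (envelopingIncl H).toRingHom).obj
          ((Γ.locTwistModule x).obj X)) := fun s =>
      { toFun := Γ.fraction x X s
        map_add' := map_add (Γ.fraction x X s)
        map_smul' := hσ s X }
    -- The fractions with denominator `s` form a semisimple submodule, and these submodules
    -- exhaust the localization.
    refine isSemisimpleModule_of_isSemisimpleModule_submodule'
      (p := fun s => LinearMap.range (l s)) (fun s => isSemisimpleModule_range (l s)) ?_
    rw [eq_top_iff]
    intro z _
    obtain ⟨s, v, rfl⟩ := exists_fraction_eq (x := x) (X := X) z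
    exact Submodule.mem_iSup_of_mem s ⟨v, rfl⟩
  · intro z
    obtain ⟨s, v, rfl⟩ := exists_fraction_eq (x := x) (X := X) z
    obtain ⟨σ, hσ⟩ := Γ.exists_algEquiv_fraction x s
    exact finite_span_of_surjective (N := ((ModuleCat.restrictScalars
        (envelopingIncl H).toRingHom).obj X)) σ.toAlgHom σ.surjective
      (N' := (ModuleCat.restrictScalars (envelopingIncl H).toRingHom).obj
        ((Γ.locTwistModule x).obj X)) (Γ.fraction x X s) (hσ X) v (h2 v)

/-- Localization followed by the twist, as an endofunctor of the category of `(g, H)`-modules. -/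
noncomputable def locTwist (x : Γ.roots → ℂ) : GHMod H ⥤ GHMod H :=
  (isGHModule H).lift ((isGHModule H).ι ⋙ Γ.locTwistModule x) fun M =>
    Γ.isGHModule_locTwistModule x M.property

instance (x : Γ.roots → ℂ) : (Γ.locTwist x).Additive where
  map_add := by
    intros
    ext : 1
    exact (Γ.locTwistModule x).map_add

instance (x : Γ.roots → ℂ) : (Γ.locTwist x).Linear ℂ where
  map_smul f c := by
    ext z
    obtain ⟨s, v, rfl⟩ := exists_fraction_eq z
    exact Γ.fraction_smul x _ s c (f.hom v)

omit [FiniteDimensional ℂ g] [LieAlgebra.HasCentralRadical ℂ g] [H.IsCartanSubalgebra] in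
instance preservesFiniteLimits_ι : Limits.PreservesFiniteLimits (isGHModule H).ι := by
  have : ∀ {X Y : GHMod H} (f : X ⟶ Y),
      Limits.PreservesLimit (Limits.parallelPair f 0) (isGHModule H).ι :=
    fun f => (isGHModule H).preservesKernels_ι f
  exact Functor.preservesFiniteLimits_of_preservesKernels _

omit [FiniteDimensional ℂ g] [LieAlgebra.HasCentralRadical ℂ g] [H.IsCartanSubalgebra] in
instance preservesFiniteColimits_ι : Limits.PreservesFiniteColimits (isGHModule H).ι := by
  have : ∀ {X Y : GHMod H} (f : X ⟶ Y),
      Limits.PreservesColimit (Limits.parallelPair f 0) (isGHModule H).ι :=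
    fun f => (isGHModule H).preservesCokernels_ι f
  exact Functor.preservesFiniteColimits_of_preservesCokernels _

instance (x : Γ.roots → ℂ) : Limits.PreservesFiniteLimits (Γ.locTwist x) := by
  have : Limits.PreservesFiniteLimits (Γ.locTwist x ⋙ (isGHModule H).ι) :=
    inferInstanceAs (Limits.PreservesFiniteLimits ((isGHModule H).ι ⋙ Γ.locTwistModule x))
  exact Limits.preservesFiniteLimits_of_reflects_of_preserves _ (isGHModule H).ι

instance (x : Γ.roots → ℂ) : Limits.PreservesFiniteColimits (Γ.locTwist x) := by
  have : Limits.PreservesFiniteColimits (Γ.locTwist x ⋙ (isGHModule H).ι) :=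
    inferInstanceAs (Limits.PreservesFiniteColimits ((isGHModule H).ι ⋙ Γ.locTwistModule x))
  exact Limits.preservesFiniteColimits_of_reflects_of_preserves _ (isGHModule H).ι

end CommutingSet

end WeightMod

namespace WeightMod.CommutingSet

variable {g : Type u} [LieRing g] [LieAlgebra ℂ g] {H : LieSubalgebra ℂ g} (Γ : CommutingSet H)

variable [FiniteDimensional ℂ g] [LieAlgebra.HasCentralRadical ℂ g] [H.IsCartanSubalgebra]

/-! ### Bijective modules and the inverse twist -/

variable {Γ} in
omit [FiniteDimensional ℂ g] [LieAlgebra.HasCentralRadical ℂ g] [H.IsCartanSubalgebra] in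
theorem bijective_multSet_smul {M : GHMod H} (hM : Γ.isBijective M) (s : Γ.multSet) :
    Function.Bijective fun v : M.obj => (s : UniversalEnvelopingAlgebra ℂ g) • v :=
  (Module.End.isUnit_iff _).1 (isUnit_multSet ⟨M, hM⟩ s)

variable {Γ} in
omit [LieAlgebra.HasCentralRadical ℂ g] in
theorem bijective_numeratorAddHom {M : GHMod H} (hM : Γ.isBijective M) :
    Function.Bijective (OreLocalization.numeratorAddHom Γ.multSet M.obj) :=
  OreLocalization.bijective_numeratorAddHom (bijective_multSet_smul hM)

/-- Localized modules are `Γ`-bijective, whether twisted or not, as `Θ_x` preserves units. -/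
theorem isBijective_locTwist (x : Γ.roots → ℂ) (M : GHMod H) :
    Γ.isBijective ((Γ.locTwist x).obj M) := by
  intro γ
  have hu : IsUnit (Γ.theta x (Γ.toLoc (Γ.rootVec γ))) :=
    (Γ.rootUnit γ).isUnit.map (Γ.theta x)
  exact MulAction.bijective (β := OreLocalization Γ.multSet M.obj) hu.unit

/-- The canonical map of the module `X`, localized and twisted by `Θ_x`, to its localization is
linear over `U_Γ`. -/
theorem numeratorAddHom_theta_smul (x : Γ.roots → ℂ)
    (X : ModuleCat.{u} (UniversalEnvelopingAlgebra ℂ g)) (u : Γ.Loc)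
    (z : OreLocalization Γ.multSet X) :
    OreLocalization.numeratorAddHom Γ.multSet ((Γ.locTwistModule x).obj X) (Γ.theta x u • z) =
      u • OreLocalization.numeratorAddHom Γ.multSet ((Γ.locTwistModule x).obj X) z :=
  OreLocalization.map_smul_of_numerator
    (A := (ModuleCat.restrictScalars (Γ.theta x).toRingEquiv.toRingHom).obj
      ((OreLocalization.moduleFunctor Γ.multSet).obj X))
    (OreLocalization.numeratorAddHom Γ.multSet ((Γ.locTwistModule x).obj X))
    (fun r a => OreLocalization.numeratorAddHom_smul r (X := (Γ.locTwistModule x).obj X) a) u z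

/-- The map `v ↦ (v / 1) / 1` from a module to the module obtained by localizing and twisting with
`Θ_x` and then with `Θ_{-x}`. It is linear because `Θ_x ∘ Θ_{-x} = 1`. -/
noncomputable def toLocTwistTwice (x : Γ.roots → ℂ)
    (X : ModuleCat.{u} (UniversalEnvelopingAlgebra ℂ g)) :
    X ⟶ (Γ.locTwistModule (-x)).obj ((Γ.locTwistModule x).obj X) :=
  ModuleCat.ofHom (Y := (Γ.locTwistModule (-x)).obj ((Γ.locTwistModule x).obj X))
    { toFun := fun v => Γ.fraction (-x) _ 1 (Γ.fraction x X 1 v)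
      map_add' := fun v w => by rw [map_add, map_add]
      map_smul' := fun r v => by
        have h := Γ.numeratorAddHom_theta_smul x X (Γ.theta (-x) (Γ.toLoc r))
          (OreLocalization.numeratorAddHom Γ.multSet X v)
        rw [theta_theta_neg] at h
        refine Eq.trans ?_ h
        exact congrArg (OreLocalization.numeratorAddHom Γ.multSet ((Γ.locTwistModule x).obj X))
          (OreLocalization.numeratorAddHom_smul r v) }

/-- The natural map of a `(g, H)`-module to its localization, the latter being twisted back and
forth. -/
noncomputable def locTwistUnit (x : Γ.roots → ℂ) :
    𝟭 (GHMod H) ⟶ Γ.locTwist x ⋙ Γ.locTwist (-x) where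
  app M := ObjectProperty.homMk (Γ.toLocTwistTwice x M.obj)
  naturality _ _ _ := rfl

theorem isIso_locTwistUnit_app (x : Γ.roots → ℂ) {M : GHMod H} (hM : Γ.isBijective M) :
    IsIso ((Γ.locTwistUnit x).app M) := by
  have h : Function.Bijective ((Γ.locTwistUnit x).app M).hom :=
    (bijective_numeratorAddHom (Γ.isBijective_locTwist x M)).comp (bijective_numeratorAddHom hM)
  have : IsIso ((isGHModule H).ι.map ((Γ.locTwistUnit x).app M)) :=
    (ConcreteCategory.isIso_iff_bijective _).2 h
  exact isIso_of_reflects_iso _ (isGHModule H).ι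

/-- A `Γ`-bijective module is isomorphic to its localization over `U_Γ`. -/
noncomputable def toLocModuleIso (M : Γ.BijMod) :
    Γ.toLocModule.obj M ≅ (OreLocalization.moduleFunctor Γ.multSet).obj M.obj.obj :=
  let l : Γ.toLocModule.obj M →ₗ[Γ.Loc]
      (OreLocalization.moduleFunctor Γ.multSet).obj M.obj.obj :=
    { toFun := OreLocalization.numeratorAddHom Γ.multSet M.obj.obj
      map_add' := map_add (OreLocalization.numeratorAddHom Γ.multSet M.obj.obj)
      map_smul' := OreLocalization.map_smul_of_numerator
        (A := Γ.toLocModule.obj M) (OreLocalization.numeratorAddHom Γ.multSet M.obj.obj)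
        fun r a => (congrArg (OreLocalization.numeratorAddHom Γ.multSet M.obj.obj)
          (locAction_toLoc M r a)).trans
            (OreLocalization.numeratorAddHom_smul r (X := M.obj.obj) a) }
  (LinearEquiv.ofBijective l (bijective_numeratorAddHom M.property)).toModuleIso

/-- On `Γ`-bijective modules, localizing before twisting changes nothing. -/
noncomputable def twistIso (x : Γ.roots → ℂ) (M : Γ.BijMod) :
    ((Γ.twist x).obj M).obj ≅ (Γ.locTwist x).obj M.obj :=
  (isGHModule H).isoMk ((ModuleCat.restrictScalars (Γ.theta x).toRingEquiv.toRingHom ⋙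
    ModuleCat.restrictScalars Γ.toLoc.toRingHom).mapIso (Γ.toLocModuleIso M))

theorem bijective_mapExtLinearMap_locTwist (x : Γ.roots → ℂ) {M N : GHMod H}
    (hM : Γ.isBijective M) (hN : Γ.isBijective N) (i : ℕ) :
    Function.Bijective ((Γ.locTwist x).mapExtLinearMap ℂ M N i) := by
  have := Γ.isIso_locTwistUnit_app x hM
  have := Γ.isIso_locTwistUnit_app x hN
  let σ : 𝟭 (GHMod H) ⟶ Γ.locTwist (-x) ⋙ Γ.locTwist x :=
    Γ.locTwistUnit (-x) ≫ eqToHom (by rw [neg_neg])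
  -- The image of `locTwist x` consists of `Γ`-bijective modules, so that `σ` is invertible on it.
  have (K : GHMod H) : IsIso (σ.app ((Γ.locTwist x).obj K)) := by
    have := Γ.isIso_locTwistUnit_app (-x) (Γ.isBijective_locTwist x K)
    rw [NatTrans.comp_app]
    infer_instance
  exact Abelian.Ext.bijective_mapExactFunctor (Γ.locTwist x) (Γ.locTwist (-x))
    (Γ.locTwistUnit x) σ M N i

end WeightMod.CommutingSet

theorem proposition4p5 {g : Type u} [LieRing g] [LieAlgebra ℂ g] [FiniteDimensional ℂ g]
    [LieAlgebra.HasCentralRadical ℂ g] (H : LieSubalgebra ℂ g) [H.IsCartanSubalgebra]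
    (Γ : WeightMod.CommutingSet H) (x : Γ.roots → ℂ) (M N : Γ.BijMod) (i : ℕ) :
    Nonempty (CategoryTheory.Abelian.Ext M.obj N.obj i ≃ₗ[ℂ]
      CategoryTheory.Abelian.Ext ((Γ.twist x).obj M).obj ((Γ.twist x).obj N).obj i) :=
  ⟨(LinearEquiv.ofBijective _
    (Γ.bijective_mapExtLinearMap_locTwist x M.property N.property i)).trans
    (Abelian.Ext.linearEquivOfIso ℂ (Γ.twistIso x M).symm (Γ.twistIso x N).symm i)⟩
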